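/- Let $(\Omega,m)$ be a measurable space with a filtration $(\mathcal F_n)_{n\ge 0}$, $\mathcal F_0$ trivial, and let $(E_n^{(1)})_{n\ge1}$, $(E_n^{(2)})_{n\ge1}$ be real-valued adapted sequences. Call a probability measure $P$ an *i.i.d. law* if under $P$ the pairs $(E_n^{(1)},E_n^{(2)})$, $n\ge1$, are identically distributed and $(E_n^{(1)},E_n^{(2)})$ is independent of $\mathcal F_{n-1}$ for every $n\ge 1$. The null $\mathcal P$ is the set of all i.i.d. laws $P$ under which $E_1^{(1)}$ and $E_1^{(2)}$ are $e$-values, i.e. $E_1^{(j)}\ge 0$ $P$-a.s. and $\mathbb E_P[E_1^{(j)}]\le 1$ for $j=1,2$. The alternative $\mathcal Q$ is an arbitrary set of i.i.d. laws $Q$ with $E_1^{(1)},E_1^{(2)}\ge 0$ $Q$-a.s. A betting strategy is a $[0,1]$-valued predictable sequence $(\lambda_n)_{n\ge1}$ (i.e. $\lambda_n$ is $\mathcal F_{n-1}$-measurable), with wealth $W_n(\lambda_1,\dots,\lambda_n)=\prod_{i=1}^n\big((1-\lambda_i)E_i^{(1)}+\lambda_iE_i^{(2)}\big)$; write $W_n(\lambda)$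 for the wealth of the constant strategy $\lambda\in[0,1]$, $W_0(\lambda)=1$. A test $P$-supermartingale is a nonnegative ($P$-a.s.) $P$-supermartingale $M$ with $\mathbb E_P[M_1]\le1$; a $\mathcal P$-$e$-process is an adapted process that for every $P\in\mathcal P$ is $P$-a.s. nonnegative and $P$-a.s. bounded above by a test $P$-supermartingale. Let $\mathcal W$ be the class of $\mathcal P$-$e$-processes $W$ for which there is a betting strategy whose wealth process $\overline W$ is a test $P$-supermartingale for every $P\in\mathcal P$ and satisfies $0\le W_n\le\overline W_n$ for all $n\ge1$, almost surely under every law in $\mathcal P\cup\mathcal Q$. Logarithms are extended-real valued, $\log 0=-\infty$, and the difference of the logarithms of two quantities that are both $0$ is taken to be $0$. A process $W^\star\in\mathcal W$ is *$\mathcal Q$-universally log-optimal* if for every $Q\in\mathcal Q$ and every $W\in\mathcal W$, $$\liminf_{n\to\infty}\frac1n\big(\log W_n^\star-\log W_n\big)\ge0\quad Q\text{-a.s.},$$ and $W,W'\in\mathcal W$ are *$Q$-a.s. equivalent with rate $a_n/n$* if $\frac1n(\log W_n-\log W_n')=o(a_n/n)$ $Q$-a.s. Let $F$ be the Beta$(1/2,1/2)$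 distribution and define $$\lambda_n^{\mathrm{UP}}=\frac{\int_0^1\lambda W_{n-1}(\lambda)\,dF(\lambda)}{\int_0^1W_{n-1}(\lambda)\,dF(\lambda)}\quad(0/0:=0),\qquad W_n^{\mathrm{UP}}=\prod_{i=1}^n\big((1-\lambda_i^{\mathrm{UP}})E_i^{(1)}+\lambda_i^{\mathrm{UP}}E_i^{(2)}\big).$$ Let $\lambda_n^{\max}$ be any $\mathcal F_n$-measurable selection of $\operatorname{argmax}_{\lambda\in[0,1]}W_n(\lambda)$, and let $$W_n^{\mathrm{CO96}}=\exp\Big\{\log W_n(\lambda_n^{\max})-\tfrac12\log(n+1)-\log2\Big\},$$ $$W_n^{\mathrm{OJ23}}=\exp\Big\{\log W_n(\lambda_n^{\max})-\max_{0\le j\le n}\log\frac{\pi(\lambda_n^{\max})^j(1-\lambda_n^{\max})^{n-j}\Gamma(n+1)}{\Gamma(j+1/2)\Gamma(n-j+1/2)}\Big\}.$$ Then $W^{\mathrm{UP}}$, $W^{\mathrm{CO96}}$ and $W^{\mathrm{OJ23}}$ belong to $\mathcal W$ and are all $\mathcal Q$-universally log-optimal; for every $Q\in\mathcal Q$ they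 are pairwise $Q$-a.s. equivalent with rate $\log^2(n)/n$; and for every $Q\in\mathcal Q$, $Q$-a.s., $W_n^{\mathrm{CO96}}\le W_n^{\mathrm{OJ23}}\le W_n^{\mathrm{UP}}$ for all $n$. -/

import Mathlib

open MeasureTheory ProbabilityTheory Filter

noncomputable section

namespace Portfolio

variable {Ω : Type*} {m : MeasurableSpace Ω}

/-! ### The data: two sequences of stocks, null and alternative

`E₁ i` and `E₂ i` are the values of the two stocks in round `i = 1, 2, …` (index `0` is unused). -/

/-- The pairs `(E₁ n, E₂ n)`, `n ≥ 1`, are i.i.d. under `P` with respect to the filtration `ℱ`: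
they are identically distributed and the pair of round `n + 1` is independent of `ℱ n`. -/
def IIDPairs (ℱ : Filtration ℕ m) (E₁ E₂ : ℕ → Ω → ℝ) (P : Measure Ω) : Prop :=
  ∀ n : ℕ,
    IdentDistrib (fun ω => (E₁ (n + 1) ω, E₂ (n + 1) ω)) (fun ω => (E₁ 1 ω, E₂ 1 ω)) P P ∧
    Indep (ℱ n)
      (MeasurableSpace.comap (fun ω => (E₁ (n + 1) ω, E₂ (n + 1) ω)) inferInstance) P

/-- `X` is an e-value under `P`: it is `P`-a.s. nonnegative with `P`-expectation at most one. -/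
def IsEValue (P : Measure Ω) (X : Ω → ℝ) : Prop :=
  (∀ᵐ ω ∂P, 0 ≤ X ω) ∧ ∫⁻ ω, ENNReal.ofReal (X ω) ∂P ≤ 1

/-- The null hypothesis: the laws under which the pairs are i.i.d. and both `E₁ 1` and `E₂ 1` are
e-values. -/
def nullHypothesis (ℱ : Filtration ℕ m) (E₁ E₂ : ℕ → Ω → ℝ) : Set (Measure Ω) :=
  {P | IsProbabilityMeasure P ∧ IIDPairs ℱ E₁ E₂ P ∧ IsEValue P (E₁ 1) ∧ IsEValue P (E₂ 1)}

/-- `𝒬` is an admissible alternative hypothesis: a set of probability measures, under each of which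
the pairs are i.i.d. and almost surely nonnegative. -/
def IsAlternative (ℱ : Filtration ℕ m) (E₁ E₂ : ℕ → Ω → ℝ) (𝒬 : Set (Measure Ω)) : Prop :=
  ∀ Q ∈ 𝒬, IsProbabilityMeasure Q ∧ IIDPairs ℱ E₁ E₂ Q ∧
    (∀ᵐ ω ∂Q, 0 ≤ E₁ 1 ω) ∧ (∀ᵐ ω ∂Q, 0 ≤ E₂ 1 ω)

/-! ### Wealth processes, test supermartingales, e-processes -/

/-- Wealth `∏ i = 1, …, n` of `(1 - l i) * E₁ i + l i * E₂ i`. -/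
def wealth (E₁ E₂ : ℕ → Ω → ℝ) (l : ℕ → Ω → ℝ) (n : ℕ) (ω : Ω) : ℝ :=
  ∏ i ∈ Finset.Icc 1 n, ((1 - l i ω) * E₁ i ω + l i ω * E₂ i ω)

/-- Wealth of the constant strategy `x`. -/
def constWealth (E₁ E₂ : ℕ → Ω → ℝ) (n : ℕ) (ω : Ω) (x : ℝ) : ℝ :=
  ∏ i ∈ Finset.Icc 1 n, ((1 - x) * E₁ i ω + x * E₂ i ω)

/-- `[0, 1]`-valued predictable sequences `l 1, l 2, …`. -/
def IsStrategy (ℱ : Filtration ℕ m) (l : ℕ → Ω → ℝ) : Prop :=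
  ∀ n : ℕ, Measurable[ℱ n] (l (n + 1)) ∧ ∀ ω, l (n + 1) ω ∈ Set.Icc (0 : ℝ) 1

/-- Test `P`-supermartingales. -/
def IsTestSupermartingale (ℱ : Filtration ℕ m) (P : Measure Ω) (M : ℕ → Ω → ℝ) : Prop :=
  Supermartingale M ℱ P ∧ (∀ n, ∀ᵐ ω ∂P, 0 ≤ M n ω) ∧ ∫ ω, M 1 ω ∂P ≤ 1

/-- `H₀`-e-processes `W 1, W 2, …`. -/
def IsEProcess (ℱ : Filtration ℕ m) (H₀ : Set (Measure Ω)) (W : ℕ → Ω → ℝ) : Prop :=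
  (∀ n, 1 ≤ n → Measurable[ℱ n] (W n)) ∧
  ∀ P ∈ H₀, (∀ n, 1 ≤ n → ∀ᵐ ω ∂P, 0 ≤ W n ω) ∧
    ∃ M : ℕ → Ω → ℝ, IsTestSupermartingale ℱ P M ∧ ∀ n, 1 ≤ n → ∀ᵐ ω ∂P, W n ω ≤ M n ω

/-- The class of e-processes for the null bounded above by the wealth of a strategy (which has to be a
test supermartingale under the null). The bound holds almost surely under every law of the null and of the
alternative. -/
def eProcessClass (ℱ : Filtration ℕ m) (E₁ E₂ : ℕ → Ω → ℝ) (𝒬 : Set (Measure Ω)) :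
    Set (ℕ → Ω → ℝ) :=
  {W | IsEProcess ℱ (nullHypothesis ℱ E₁ E₂) W ∧
    ∃ l : ℕ → Ω → ℝ, IsStrategy ℱ l ∧
      (∀ P ∈ nullHypothesis ℱ E₁ E₂, IsTestSupermartingale ℱ P (wealth E₁ E₂ l)) ∧
      ∀ P ∈ nullHypothesis ℱ E₁ E₂ ∪ 𝒬, ∀ n, 1 ≤ n →
        ∀ᵐ ω ∂P, 0 ≤ W n ω ∧ W n ω ≤ wealth E₁ E₂ l n ω}

/-! ### Log-optimality and asymptotic equivalence -/

/-- `log x - log y` for `x, y ≥ 0`, in the extended reals: `log 0 = -∞`, and the difference is `0`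
if `x = y = 0`. -/
def logDiff (x y : ℝ) : EReal :=
  open Classical in
  if x ≤ 0 ∧ y ≤ 0 then 0
  else ENNReal.log (ENNReal.ofReal x) - ENNReal.log (ENNReal.ofReal y)

/-- `Wstar` is `Q`-almost surely log-optimal within the class `𝒲`. -/
def IsLogOptimal (𝒲 : Set (ℕ → Ω → ℝ)) (Q : Measure Ω) (Wstar : ℕ → Ω → ℝ) : Prop :=
  Wstar ∈ 𝒲 ∧ ∀ W ∈ 𝒲, ∀ᵐ ω ∂Q,
    0 ≤ liminf (fun n : ℕ => ((1 / (n : ℝ) : ℝ) : EReal) * logDiff (Wstar n ω) (W n ω)) atTop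

/-- `Wstar` is `𝒬`-universally log-optimal within `𝒲`. -/
def IsUniversallyLogOptimal (𝒲 : Set (ℕ → Ω → ℝ)) (𝒬 : Set (Measure Ω)) (Wstar : ℕ → Ω → ℝ) :
    Prop :=
  Wstar ∈ 𝒲 ∧ ∀ Q ∈ 𝒬, IsLogOptimal 𝒲 Q Wstar

/-- `W` and `W'` in `𝒲` are `Q`-almost surely asymptotically equivalent with rate `a n / n`:
`(1 / n) * (log (W n) - log (W' n)) = o (a n / n)`, `Q`-almost surely. -/
def AsympEquiv (𝒲 : Set (ℕ → Ω → ℝ)) (Q : Measure Ω) (a : ℕ → ℝ) (W W' : ℕ → Ω → ℝ) : Prop :=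
  W ∈ 𝒲 ∧ W' ∈ 𝒲 ∧ ∀ᵐ ω ∂Q, ∀ c : ℝ, 0 < c → ∀ᶠ n : ℕ in atTop,
    (((1 / (n : ℝ) : ℝ) : EReal) * logDiff (W n ω) (W' n ω)).abs ≤
      ENNReal.ofReal (c * |a n / n|)

/-! ### The three processes -/

/-- The universal portfolio bet of round `n ≥ 1`: the average of `x` weighted by the wealth at time
`n - 1`, with respect to the Beta(1/2, 1/2) distribution. -/
def upBet (E₁ E₂ : ℕ → Ω → ℝ) (n : ℕ) (ω : Ω) : ℝ :=
  (∫ x, x * constWealth E₁ E₂ (n - 1) ω x ∂(betaMeasure (1 / 2) (1 / 2))) /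
    (∫ x, constWealth E₁ E₂ (n - 1) ω x ∂(betaMeasure (1 / 2) (1 / 2)))

/-- The wealth of the universal portfolio. -/
def wealthUP (E₁ E₂ : ℕ → Ω → ℝ) (n : ℕ) (ω : Ω) : ℝ :=
  wealth E₁ E₂ (upBet E₁ E₂) n ω

/-- `lmax n ω` is a maximizer of the wealth at time `n` among the constant strategies, chosen
measurably from the data up to time `n`. -/
def IsArgmaxSelection (ℱ : Filtration ℕ m) (E₁ E₂ : ℕ → Ω → ℝ) (lmax : ℕ → Ω → ℝ) : Prop :=
  ∀ n : ℕ, Measurable[ℱ n] (lmax n) ∧ ∀ ω, lmax n ω ∈ Set.Icc (0 : ℝ) 1 ∧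
    ∀ x ∈ Set.Icc (0 : ℝ) 1, constWealth E₁ E₂ n ω x ≤ constWealth E₁ E₂ n ω (lmax n ω)

/-- The Cover–Ordentlich regret bound. -/
def regretCO (n : ℕ) : ℝ := Real.log (n + 1) / 2 + Real.log 2

/-- The Orabona–Jun regret bound at the empirical maximizer `x`. The logarithm is applied to the
maximum over `j` (rather than to each term), since some of the terms vanish for `x = 0` and
`x = 1`, where their logarithms would be `-∞`; the maximum is positive. -/
def regretOJ (n : ℕ) (x : ℝ) : ℝ :=
  Real.log ((Finset.range (n + 1)).sup' Finset.nonempty_range_add_one (fun j : ℕ =>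
    Real.pi * x ^ j * (1 - x) ^ (n - j) * Real.Gamma ((n : ℝ) + 1) /
      (Real.Gamma ((j : ℝ) + 1 / 2) * Real.Gamma ((n : ℝ) - (j : ℝ) + 1 / 2))))

/-- `exp (log w - r)` for `w ≥ 0`, with `log 0 = -∞` and `exp (-∞) = 0`. -/
def expLogSub (w r : ℝ) : ℝ := w * Real.exp (-r)

theorem expLogSub_eq {w : ℝ} (hw : 0 < w) (r : ℝ) : expLogSub w r = Real.exp (Real.log w - r) := by
  rw [expLogSub, sub_eq_add_neg, Real.exp_add, Real.exp_log hw]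

theorem expLogSub_zero (r : ℝ) : expLogSub 0 r = 0 := zero_mul _

/-- Maximal log-wealth minus the Cover–Ordentlich regret bound, exponentiated. -/
def wealthCO (E₁ E₂ : ℕ → Ω → ℝ) (lmax : ℕ → Ω → ℝ) (n : ℕ) (ω : Ω) : ℝ :=
  expLogSub (constWealth E₁ E₂ n ω (lmax n ω)) (regretCO n)

/-- Maximal log-wealth minus the Orabona–Jun regret bound, exponentiated. -/
def wealthOJ (E₁ E₂ : ℕ → Ω → ℝ) (lmax : ℕ → Ω → ℝ) (n : ℕ) (ω : Ω) : ℝ :=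
  expLogSub (constWealth E₁ E₂ n ω (lmax n ω)) (regretOJ n (lmax n ω))

end Portfolio

end

/-! Let `V n` denote the wealth at time `n` of the best constant strategy in hindsight. The argument
combines a pathwise sandwich with a growth bound for arbitrary strategies.

Sandwich, for nonnegative stocks: `V n / (2√(n+1)) = wealthCO ≤ wealthOJ ≤ wealthUP ≤ V n`. The
universal wealth is the Beta(1/2, 1/2) average of the constant wealths (`wealthUP_eq_integral`),
hence at most `V n`. A constant wealth expands into a nonnegative combination of monomials `x ^ j *
(1 - x) ^ (n - j)`, whose Beta means are explicit. The largest ratio of a monomial to its mean is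
the exponential of the Orabona–Jun regret (`expLogSub_regretOJ_le_wealthUP`), and Stirling estimates
bound every such ratio by `2√(n+1)` (`pi_mul_pow_mul_pow_mul_factorial_le`). Membership in the class
follows: the universal portfolio is almost surely the wealth of a strategy, a test supermartingale
under the null, and the other two processes lie below it.

Growth: under `Q`, for each `ε` in `(0, 1]` some constant strategy `x` makes the mean of each stock
relative to the mixture at most `1 + ε` (`exists_near_numeraire`). The wealth of any strategy
relative to that of `x` then has mean at most `(1 + ε) ^ n`, so by Markov and Borel–Cantelli it is
eventually below `exp (2εn)`. No integrability of log-returns is needed. Since `V n` dominates the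
wealth of `x` and each process loses at most the factor `2√(n+1)`, letting `ε → 0` gives
log-optimality. The logarithm of that factor is `O(log n) = o(log² n)`, which gives the equivalence.
-/

noncomputable section

namespace Portfolio

/-! ### Bounds on Gamma ratios -/

/-- Gibbs' inequality: the likelihood is largest at `x = j / (j + k)`. It follows from `t ≤ exp (t -
1)` at `t = x * N / j` and `t = y * N / k`, because the resulting exponents cancel when `x + y = 1`.
-/
theorem pow_mul_pow_le_of_add_eq_one {x y : ℝ} (hx : 0 ≤ x) (hy : 0 ≤ y) (hxy : x + y = 1)
    (j k : ℕ) (hj : j ≠ 0) (hk : k ≠ 0) :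
    x ^ j * y ^ k * ((j + k : ℕ) : ℝ) ^ (j + k) ≤ (j : ℝ) ^ j * (k : ℝ) ^ k := by
  set N : ℝ := ((j + k : ℕ) : ℝ) with hN
  have hN0 : 0 ≤ N := Nat.cast_nonneg _
  have key : ∀ (z : ℝ), 0 ≤ z → ∀ i : ℕ, i ≠ 0 →
      (z * N) ^ i ≤ (i : ℝ) ^ i * Real.exp (z * N - i) := by
    intro z hz i hi
    have hi' : (0 : ℝ) < i := by positivity
    have h1 : z * N / i ≤ Real.exp (z * N / i - 1) := by
      have := Real.add_one_le_exp (z * N / i - 1); linarith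
    have h2 : (z * N / i) ^ i ≤ Real.exp (z * N - i) := by
      refine (pow_le_pow_left₀ (by positivity) h1 i).trans_eq ?_
      rw [← Real.exp_nat_mul]; congr 1; field_simp
    rw [div_pow, div_le_iff₀ (by positivity)] at h2
    linarith
  have h := mul_le_mul (key x hx j hj) (key y hy k hk) (by positivity) (by positivity)
  have he : Real.exp (x * N - j) * Real.exp (y * N - k) = 1 := by
    rw [← Real.exp_add, Real.exp_eq_one_iff]
    have : x * N - j + (y * N - k) = (x + y) * N - (j + k) := by ring
    rw [this, hxy, hN]; push_cast; ring
  calc x ^ j * y ^ k * N ^ (j + k) = (x * N) ^ j * (y * N) ^ k := by rw [pow_add]; ring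
    _ ≤ _ := h
    _ = (j : ℝ) ^ j * (k : ℝ) ^ k * (Real.exp (x * N - j) * Real.exp (y * N - k)) := by ring
    _ = _ := by rw [he, mul_one]

theorem Gamma_nat_add_half_mul (j : ℕ) :
    Real.Gamma (j + 1 / 2) * (4 ^ j * (j.factorial : ℝ)) = (2 * j).factorial * √Real.pi := by
  induction j with
  | zero => simp [Real.Gamma_one_half_eq, -one_div]
  | succ j ih =>
    have h1 : Real.Gamma ((j + 1 : ℕ) + 1 / 2) = (j + 1 / 2) * Real.Gamma (j + 1 / 2) := by
      rw [← Real.Gamma_add_one (by positivity)]; push_cast; congr 1; ring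
    have h2 : ((2 * (j + 1)).factorial : ℝ) = (2 * j + 2) * (2 * j + 1) * (2 * j).factorial := by
      rw [show 2 * (j + 1) = 2 * j + 1 + 1 by ring, Nat.factorial_succ, Nat.factorial_succ]
      push_cast; ring
    rw [h1, h2, Nat.factorial_succ, pow_succ]
    push_cast
    linear_combination ((2 * j + 2) * (2 * j + 1) : ℝ) * ih

/-- The Stirling sequence decreases from its value `e / √2` at index one. -/
theorem factorial_le_stirling {n : ℕ} (hn : n ≠ 0) :
    (n.factorial : ℝ) ≤ Real.exp 1 * √n * (n / Real.exp 1) ^ n := by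
  obtain ⟨k, rfl⟩ := Nat.exists_eq_succ_of_ne_zero hn
  have h : Stirling.stirlingSeq (k + 1) ≤ Real.exp 1 / √2 := by
    have := Stirling.stirlingSeq'_antitone (Nat.zero_le k)
    simpa using this
  unfold Stirling.stirlingSeq at h
  rw [div_le_iff₀ (by positivity)] at h
  refine h.trans_eq ?_
  rw [Real.sqrt_mul (by norm_num)]
  field_simp

/-- In `Γ(n + 1/2) = (2n)! √π / (4 ^ n n!)`, Stirling is applied from below to `(2n)!` and from
above to `n!`; the factors `√n` cancel. -/
theorem le_Gamma_nat_add_half {n : ℕ} (hn : n ≠ 0) :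
    2 * Real.pi / Real.exp 1 * (n / Real.exp 1) ^ n ≤ Real.Gamma (n + 1 / 2) := by
  have h1 := factorial_le_stirling hn
  have h2 := Stirling.le_factorial_stirling (2 * n)
  have h3 := Gamma_nat_add_half_mul n
  have hn' : (0 : ℝ) < n := by positivity
  have hG : 0 < Real.Gamma (n + 1 / 2) := Real.Gamma_pos_of_pos (by positivity)
  have h4 : √(2 * Real.pi * ((2 * n : ℕ) : ℝ)) = 2 * √Real.pi * √n := by
    rw [← Real.sqrt_mul_self (by positivity : (0:ℝ) ≤ 2), ← Real.sqrt_mul (by norm_num),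
      ← Real.sqrt_mul (by positivity)]
    congr 1; push_cast; rw [Real.sqrt_mul_self (by norm_num)]; ring
  have h5 : (((2 * n : ℕ) : ℝ) / Real.exp 1) ^ (2 * n) =
      4 ^ n * (n / Real.exp 1) ^ n * (n / Real.exp 1) ^ n := by
    push_cast
    rw [pow_mul, ← mul_pow, ← mul_pow]; congr 1; ring
  set A : ℝ := (n / Real.exp 1) ^ n with hA
  have hA0 : 0 < A := by positivity
  have hπ : √Real.pi * √Real.pi = Real.pi := Real.mul_self_sqrt Real.pi_pos.le
  have h6 : 2 * √Real.pi * √n * (4 ^ n * A * A) * √Real.pi ≤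
      Real.Gamma (n + 1 / 2) * (4 ^ n * (Real.exp 1 * √n * A)) := by
    calc _ ≤ ((2 * n).factorial : ℝ) * √Real.pi := by
            rw [h4, h5] at h2
            exact mul_le_mul_of_nonneg_right h2 (Real.sqrt_nonneg _)
      _ = _ := h3.symm
      _ ≤ _ := by gcongr
  have hpos : 0 < √(n : ℝ) * 4 ^ n * A := by positivity
  have h7 : (2 * Real.pi * A) * (√(n : ℝ) * 4 ^ n * A) ≤
      (Real.Gamma (n + 1 / 2) * Real.exp 1) * (√(n : ℝ) * 4 ^ n * A) := by
    rw [← hπ]; nlinarith [h6]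
  have h8 := le_of_mul_le_mul_right h7 hpos
  rw [div_mul_eq_mul_div, div_le_iff₀ (Real.exp_pos 1)]
  exact h8

/-- Log-convexity of `Γ` at `n + 1`, the midpoint of `n + 1/2` and `n + 3/2`, together with `√π ≤
2`. -/
theorem sqrt_pi_mul_factorial_le (n : ℕ) :
    √Real.pi * n.factorial ≤ 2 * √(n + 1) * Real.Gamma (n + 1 / 2) := by
  have hG : 0 < Real.Gamma (n + 1 / 2) := Real.Gamma_pos_of_pos (by positivity)
  have h := Real.Gamma_mul_add_mul_le_rpow_Gamma_mul_rpow_Gamma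
    (s := (n : ℝ) + 1 / 2) (t := (n : ℝ) + 1 / 2 + 1) (a := 1 / 2) (b := 1 / 2)
    (by positivity) (by positivity) (by norm_num) (by norm_num) (by norm_num)
  rw [Real.Gamma_add_one (by positivity), ← Real.sqrt_eq_rpow, ← Real.sqrt_eq_rpow,
    Real.sqrt_mul (by positivity), show (1 / 2 : ℝ) * (n + 1 / 2) + 1 / 2 * (n + 1 / 2 + 1) = n + 1
      by ring, Real.Gamma_nat_eq_factorial] at h
  have h1 : √(Real.Gamma (n + 1 / 2)) * √(Real.Gamma (n + 1 / 2)) = Real.Gamma (n + 1 / 2) :=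
    Real.mul_self_sqrt hG.le
  have h2 : (n.factorial : ℝ) ≤ √(n + 1 / 2) * Real.Gamma (n + 1 / 2) := by
    refine h.trans_eq ?_
    linear_combination √((n : ℝ) + 1 / 2) * h1
  have h3 : √Real.pi ≤ 2 := Real.sqrt_le_iff.2 ⟨by norm_num, by nlinarith [Real.pi_le_four]⟩
  have h4 : √((n : ℝ) + 1 / 2) ≤ √(n + 1) := Real.sqrt_le_sqrt (by linarith)
  calc _ ≤ 2 * (√(n + 1 / 2) * Real.Gamma (n + 1 / 2)) := by gcongr
    _ ≤ 2 * (√(n + 1) * Real.Gamma (n + 1 / 2)) := by gcongr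
    _ = _ := by ring

/-- The Cover–Ordentlich bound for the two-stock universal portfolio. -/
theorem pi_mul_pow_mul_pow_mul_factorial_le {x y : ℝ} (hx : 0 ≤ x) (hy : 0 ≤ y) (hxy : x + y = 1)
    (j k : ℕ) :
    Real.pi * x ^ j * y ^ k * (j + k).factorial ≤
      2 * √((j + k : ℕ) + 1) * (Real.Gamma (j + 1 / 2) * Real.Gamma (k + 1 / 2)) := by
  have hπ : √Real.pi * √Real.pi = Real.pi := Real.mul_self_sqrt Real.pi_pos.le
  -- The cases `j = 0` and `k = 0` are separate because the lower bound on `Γ(n + 1/2)` fails at `n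
  -- = 0`, where `2π / e > √π`.
  have boundary : ∀ (z : ℝ), 0 ≤ z → z ≤ 1 → ∀ n : ℕ,
      Real.pi * z ^ n * n.factorial ≤ 2 * √((n : ℝ) + 1) * (√Real.pi * Real.Gamma (n + 1 / 2)) := by
    intro z hz hz1 n
    calc Real.pi * z ^ n * n.factorial ≤ Real.pi * 1 * n.factorial := by
          gcongr; exact pow_le_one₀ hz hz1
      _ = √Real.pi * (√Real.pi * n.factorial) := by linear_combination -(n.factorial : ℝ) * hπ
      _ ≤ √Real.pi * (2 * √(n + 1) * Real.Gamma (n + 1 / 2)) :=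
          mul_le_mul_of_nonneg_left (sqrt_pi_mul_factorial_le n) (Real.sqrt_nonneg _)
      _ = _ := by ring
  rcases eq_or_ne j 0 with rfl | hj
  · have := boundary y hy (by linarith) k
    simpa [Real.Gamma_one_half_eq, -one_div] using this
  rcases eq_or_ne k 0 with rfl | hk
  · have := boundary x hx (by linarith) j
    simpa [Real.Gamma_one_half_eq, -one_div, mul_comm (√Real.pi)] using this
  have hn : j + k ≠ 0 := by omega
  have h1 := factorial_le_stirling hn
  have h2 := pow_mul_pow_le_of_add_eq_one hx hy hxy j k hj hk
  have h3 := mul_le_mul (le_Gamma_nat_add_half hj) (le_Gamma_nat_add_half hk) (by positivity)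
    (Real.Gamma_pos_of_pos (by positivity)).le
  set e := Real.exp 1 with he
  have he0 : 0 < e := Real.exp_pos 1
  -- The Stirling bounds leave the constant `e ^ 3 / (4π)`, which has to be at most `2`.
  have he3 : e ^ 3 ≤ 8 * Real.pi := by
    have hlt : e < 2.7182818286 := Real.exp_one_lt_d9
    have : e ^ 3 ≤ 2.7182818286 ^ 3 := pow_le_pow_left₀ he0.le hlt.le 3
    have := Real.pi_gt_three
    norm_num at *
    linarith
  have hs : √((j + k : ℕ) : ℝ) ≤ √((j + k : ℕ) + 1) := Real.sqrt_le_sqrt (by linarith)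
  calc Real.pi * x ^ j * y ^ k * (j + k).factorial
      ≤ Real.pi * x ^ j * y ^ k * (e * √((j + k : ℕ) : ℝ) * (((j + k : ℕ) : ℝ) / e) ^ (j + k)) := by
        gcongr
    _ = Real.pi * e * √((j + k : ℕ) : ℝ) / e ^ (j + k) *
        (x ^ j * y ^ k * ((j + k : ℕ) : ℝ) ^ (j + k)) := by rw [div_pow]; ring
    _ ≤ Real.pi * e * √((j + k : ℕ) : ℝ) / e ^ (j + k) * ((j : ℝ) ^ j * (k : ℝ) ^ k) := by gcongr
    _ = e ^ 3 / (4 * Real.pi) * √((j + k : ℕ) : ℝ) *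
        (2 * Real.pi / e * (j / e) ^ j * (2 * Real.pi / e * (k / e) ^ k)) := by
        rw [div_pow, div_pow, pow_add]; field_simp; ring
    _ ≤ 2 * √((j + k : ℕ) + 1) *
        (2 * Real.pi / e * (j / e) ^ j * (2 * Real.pi / e * (k / e) ^ k)) := by
        gcongr
        rw [div_le_iff₀ (by positivity)]; linarith
    _ ≤ _ := by gcongr

/-! ### Moments of the Beta distribution -/

theorem betaMeasure_ae_mem_Ioo (α β : ℝ) : ∀ᵐ x ∂(betaMeasure α β), x ∈ Set.Ioo (0 : ℝ) 1 := by
  rw [betaMeasure, ae_withDensity_iff (by unfold betaPDF; fun_prop)]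
  refine ae_of_all _ fun x hx => ?_
  by_contra h
  refine hx ?_
  rw [betaPDF_eq, if_neg (by exact h), ENNReal.ofReal_zero]

theorem betaPDFReal_nonneg {α β : ℝ} (hα : 0 < α) (hβ : 0 < β) (x : ℝ) :
    0 ≤ betaPDFReal α β x := by
  by_cases h : 0 < x ∧ x < 1
  · exact (betaPDFReal_pos h.1 h.2 hα hβ).le
  · rw [betaPDFReal, if_neg h]

theorem integral_betaPDFReal {α β : ℝ} (hα : 0 < α) (hβ : 0 < β) :
    ∫ x, betaPDFReal α β x = 1 := by
  rw [integral_eq_lintegral_of_nonneg_ae (ae_of_all _ (betaPDFReal_nonneg hα hβ))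
    (by fun_prop)]
  have := lintegral_betaPDF_eq_one hα hβ
  unfold betaPDF at this
  rw [this, ENNReal.toReal_one]

/-- Multiplying the Beta(α, β) density by the monomial gives a multiple of the Beta(α + j, β + k)
density, which has total mass one. -/
theorem integral_betaMeasure_pow_mul_pow {α β : ℝ} (hα : 0 < α) (hβ : 0 < β) (j k : ℕ) :
    ∫ x, x ^ j * (1 - x) ^ k ∂(betaMeasure α β) = beta (α + j) (β + k) / beta α β := by
  have hb : 0 < beta α β := beta_pos hα hβ
  have hb' : 0 < beta (α + j) (β + k) := beta_pos (by positivity) (by positivity)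
  rw [betaMeasure]
  unfold betaPDF
  rw [integral_withDensity_eq_integral_toReal_smul (by fun_prop)
    (ae_of_all _ fun _ => ENNReal.ofReal_lt_top)]
  have : ∀ x, (ENNReal.ofReal (betaPDFReal α β x)).toReal • (x ^ j * (1 - x) ^ k) =
      beta (α + j) (β + k) / beta α β * betaPDFReal (α + j) (β + k) x := by
    intro x
    rw [ENNReal.toReal_ofReal (betaPDFReal_nonneg hα hβ x), smul_eq_mul]
    by_cases h : 0 < x ∧ x < 1
    · have h1 : 0 < 1 - x := by linarith [h.2]
      rw [betaPDFReal, betaPDFReal, if_pos h, if_pos h,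
        show α + j - 1 = α - 1 + (j : ℝ) by ring, show β + k - 1 = β - 1 + (k : ℝ) by ring,
        Real.rpow_add_natCast h.1.ne', Real.rpow_add_natCast h1.ne']
      field_simp
    · rw [betaPDFReal, betaPDFReal, if_neg h, if_neg h]; simp
  simp_rw [this]
  rw [integral_const_mul, integral_betaPDFReal (by positivity) (by positivity), mul_one]

theorem integral_betaMeasure_half_pow_mul_pow (j k : ℕ) :
    ∫ x, x ^ j * (1 - x) ^ k ∂(betaMeasure (1 / 2) (1 / 2)) =
      Real.Gamma (j + 1 / 2) * Real.Gamma (k + 1 / 2) / (Real.pi * (j + k).factorial) := by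
  rw [integral_betaMeasure_pow_mul_pow (by norm_num) (by norm_num), beta, beta,
    add_comm (1 / 2 : ℝ) (j : ℝ), add_comm (1 / 2 : ℝ) (k : ℝ), Real.Gamma_one_half_eq,
    Real.mul_self_sqrt Real.pi_pos.le,
    show (j : ℝ) + 1 / 2 + (k + 1 / 2) = ((j + k : ℕ) : ℝ) + 1 by push_cast; ring,
    Real.Gamma_nat_eq_factorial]
  norm_num
  field_simp

theorem integrable_betaMeasure_of_continuous {α β : ℝ} (hα : 0 < α) (hβ : 0 < β) {f : ℝ → ℝ}
    (hf : Continuous f) : Integrable f (betaMeasure α β) := by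
  have := isProbabilityMeasureBeta hα hβ
  obtain ⟨C, hC⟩ := isCompact_Icc.exists_bound_of_continuousOn (s := Set.Icc (0 : ℝ) 1)
    hf.continuousOn
  refine Integrable.of_bound hf.aestronglyMeasurable C ?_
  filter_upwards [betaMeasure_ae_mem_Ioo α β] with x hx using hC x ⟨hx.1.le, hx.2.le⟩

section

variable {Ω : Type*} {E₁ E₂ : ℕ → Ω → ℝ} {ω : Ω}

/-! ### Pathwise comparison of the three wealth processes -/

theorem prod_Icc_one_succ {M : Type*} [CommMonoid M] (f : ℕ → M) (n : ℕ) :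
    ∏ i ∈ Finset.Icc 1 (n + 1), f i = (∏ i ∈ Finset.Icc 1 n, f i) * f (n + 1) :=
  Finset.prod_Icc_succ_top (by omega) f

theorem wealth_succ (l : ℕ → Ω → ℝ) (n : ℕ) : wealth E₁ E₂ l (n + 1) ω =
    wealth E₁ E₂ l n ω * ((1 - l (n + 1) ω) * E₁ (n + 1) ω + l (n + 1) ω * E₂ (n + 1) ω) :=
  prod_Icc_one_succ _ n

theorem constWealth_succ (n : ℕ) (x : ℝ) : constWealth E₁ E₂ (n + 1) ω x =
    constWealth E₁ E₂ n ω x * ((1 - x) * E₁ (n + 1) ω + x * E₂ (n + 1) ω) :=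
  prod_Icc_one_succ _ n

@[fun_prop]
theorem continuous_constWealth (n : ℕ) : Continuous (constWealth E₁ E₂ n ω) := by
  unfold constWealth; fun_prop

theorem constWealth_nonneg (h₁ : ∀ n, 0 ≤ E₁ (n + 1) ω) (h₂ : ∀ n, 0 ≤ E₂ (n + 1) ω) (n : ℕ)
    {x : ℝ} (hx : x ∈ Set.Icc (0 : ℝ) 1) : 0 ≤ constWealth E₁ E₂ n ω x := by
  refine Finset.prod_nonneg fun i hi => ?_
  obtain ⟨k, rfl⟩ := Nat.exists_eq_add_of_le' (Finset.mem_Icc.1 hi).1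
  have := h₁ k; have := h₂ k; have := hx.1; have : 0 ≤ 1 - x := by linarith [hx.2]
  positivity

theorem wealth_nonneg {l : ℕ → Ω → ℝ} (hl : ∀ n, l (n + 1) ω ∈ Set.Icc (0 : ℝ) 1)
    (h₁ : ∀ n, 0 ≤ E₁ (n + 1) ω) (h₂ : ∀ n, 0 ≤ E₂ (n + 1) ω) (n : ℕ) :
    0 ≤ wealth E₁ E₂ l n ω := by
  refine Finset.prod_nonneg fun i hi => ?_
  obtain ⟨k, rfl⟩ := Nat.exists_eq_add_of_le' (Finset.mem_Icc.1 hi).1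
  have := h₁ k; have := h₂ k; have := (hl k).1
  have : 0 ≤ 1 - l (k + 1) ω := by linarith [(hl k).2]
  positivity

theorem integral_id_mul_constWealth_mem (h₁ : ∀ n, 0 ≤ E₁ (n + 1) ω)
    (h₂ : ∀ n, 0 ≤ E₂ (n + 1) ω) (n : ℕ) :
    0 ≤ ∫ x, x * constWealth E₁ E₂ n ω x ∂(betaMeasure (1 / 2) (1 / 2)) ∧
    ∫ x, x * constWealth E₁ E₂ n ω x ∂(betaMeasure (1 / 2) (1 / 2)) ≤
      ∫ x, constWealth E₁ E₂ n ω x ∂(betaMeasure (1 / 2) (1 / 2)) := by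
  constructor
  · refine integral_nonneg_of_ae ?_
    filter_upwards [betaMeasure_ae_mem_Ioo _ _] with x hx
    exact mul_nonneg hx.1.le (constWealth_nonneg h₁ h₂ n ⟨hx.1.le, hx.2.le⟩)
  · refine integral_mono_ae
      (integrable_betaMeasure_of_continuous (by norm_num) (by norm_num) (by fun_prop))
      (integrable_betaMeasure_of_continuous (by norm_num) (by norm_num) (by fun_prop)) ?_
    filter_upwards [betaMeasure_ae_mem_Ioo _ _] with x hx
    exact mul_le_of_le_one_left (constWealth_nonneg h₁ h₂ n ⟨hx.1.le, hx.2.le⟩) hx.2.le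

theorem upBet_mem_Icc (h₁ : ∀ n, 0 ≤ E₁ (n + 1) ω) (h₂ : ∀ n, 0 ≤ E₂ (n + 1) ω) (n : ℕ) :
    upBet E₁ E₂ n ω ∈ Set.Icc (0 : ℝ) 1 := by
  obtain ⟨h, h'⟩ := integral_id_mul_constWealth_mem h₁ h₂ (n - 1)
  exact ⟨div_nonneg h (h.trans h'), div_le_one_of_le₀ h' (h.trans h')⟩

/-- The wealth of the universal portfolio is the average wealth of the constant strategies. -/
theorem wealthUP_eq_integral (h₁ : ∀ n, 0 ≤ E₁ (n + 1) ω) (h₂ : ∀ n, 0 ≤ E₂ (n + 1) ω) (n : ℕ) :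
    wealthUP E₁ E₂ n ω = ∫ x, constWealth E₁ E₂ n ω x ∂(betaMeasure (1 / 2) (1 / 2)) := by
  induction n with
  | zero =>
    have := isProbabilityMeasureBeta (α := 1 / 2) (β := 1 / 2) (by norm_num) (by norm_num)
    simp only [wealthUP, wealth, constWealth, Finset.Icc_eq_empty_of_lt Nat.zero_lt_one,
      Finset.prod_empty, integral_const, probReal_univ, one_smul]
  | succ n ih =>
    obtain ⟨h, h'⟩ := integral_id_mul_constWealth_mem h₁ h₂ n
    rw [wealthUP, wealth_succ, ← wealthUP, ih, upBet, Nat.add_sub_cancel]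
    have hi : ∀ {f : ℝ → ℝ}, Continuous f → Integrable f (betaMeasure (1 / 2) (1 / 2)) :=
      fun hf => integrable_betaMeasure_of_continuous (by norm_num) (by norm_num) hf
    have hstep : ∫ x, constWealth E₁ E₂ (n + 1) ω x ∂(betaMeasure (1 / 2) (1 / 2)) =
        E₁ (n + 1) ω * ∫ x, constWealth E₁ E₂ n ω x ∂(betaMeasure (1 / 2) (1 / 2)) +
        (E₂ (n + 1) ω - E₁ (n + 1) ω) *
          ∫ x, x * constWealth E₁ E₂ n ω x ∂(betaMeasure (1 / 2) (1 / 2)) := by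
      rw [← integral_const_mul, ← integral_const_mul,
        ← integral_add (hi (by fun_prop)) (hi (by fun_prop))]
      refine integral_congr_ae (ae_of_all _ fun x => ?_)
      simp only [constWealth_succ]; ring
    rw [hstep]
    set I := ∫ x, constWealth E₁ E₂ n ω x ∂(betaMeasure (1 / 2) (1 / 2))
    set J := ∫ x, x * constWealth E₁ E₂ n ω x ∂(betaMeasure (1 / 2) (1 / 2))
    -- When the average wealth is `0`, the bet is `0 / 0 = 0`; then `J` vanishes as well, so both
    -- sides are `0`.
    rcases eq_or_ne I 0 with hI | hI
    · have hJ : J = 0 := le_antisymm (hI ▸ h') h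
      simp [hI, hJ]
    · field_simp; ring

theorem regretOJ_sup_pos (n : ℕ) {x : ℝ} (hx : x ∈ Set.Icc (0 : ℝ) 1) :
    0 < (Finset.range (n + 1)).sup' Finset.nonempty_range_add_one (fun j : ℕ =>
    Real.pi * x ^ j * (1 - x) ^ (n - j) * Real.Gamma ((n : ℝ) + 1) /
      (Real.Gamma ((j : ℝ) + 1 / 2) * Real.Gamma ((n : ℝ) - (j : ℝ) + 1 / 2))) := by
  have hΓ : 0 < Real.Gamma ((n : ℝ) + 1) := Real.Gamma_pos_of_pos (by positivity)
  have hΓ' : 0 < Real.Gamma ((n : ℝ) + 1 / 2) := Real.Gamma_pos_of_pos (by positivity)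
  have hΓ'' : 0 < Real.Gamma (1 / 2) := Real.Gamma_pos_of_pos (by positivity)
  have hπ := Real.pi_pos
  rw [Finset.lt_sup'_iff]
  -- At `x = 0` the term `j = 0` is positive; for `x > 0` the term `j = n` is, even at `x = 1`,
  -- since `0 ^ 0 = 1`.
  rcases eq_or_lt_of_le hx.1 with h0 | h0
  · refine ⟨0, by simp, ?_⟩
    simp only [← h0, Nat.cast_zero, pow_zero, sub_zero, zero_add, one_pow]
    positivity
  · refine ⟨n, by simp, ?_⟩
    simp only [Nat.sub_self, pow_zero, sub_self, zero_add]
    positivity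

theorem expLogSub_regretOJ (w : ℝ) (n : ℕ) {x : ℝ} (hx : x ∈ Set.Icc (0 : ℝ) 1) :
    expLogSub w (regretOJ n x) =
      w / (Finset.range (n + 1)).sup' Finset.nonempty_range_add_one (fun j : ℕ =>
        Real.pi * x ^ j * (1 - x) ^ (n - j) * Real.Gamma ((n : ℝ) + 1) /
        (Real.Gamma ((j : ℝ) + 1 / 2) * Real.Gamma ((n : ℝ) - (j : ℝ) + 1 / 2))) := by
  rw [expLogSub, regretOJ, Real.exp_neg, Real.exp_log (regretOJ_sup_pos n hx)]
  exact (div_eq_mul_inv _ _).symm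

theorem exp_regretCO (n : ℕ) : Real.exp (regretCO n) = 2 * √((n : ℝ) + 1) := by
  rw [regretCO, Real.exp_add, Real.exp_log (by norm_num), Real.sqrt_eq_rpow,
    Real.rpow_def_of_pos (by positivity)]
  ring_nf

theorem expLogSub_regretCO (w : ℝ) (n : ℕ) :
    expLogSub w (regretCO n) = w / (2 * √((n : ℝ) + 1)) := by
  rw [expLogSub, Real.exp_neg, exp_regretCO, div_eq_mul_inv]

theorem regretOJ_le_regretCO (n : ℕ) {x : ℝ} (hx : x ∈ Set.Icc (0 : ℝ) 1) :
    regretOJ n x ≤ regretCO n := by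
  rw [← Real.log_exp (regretCO n), exp_regretCO]
  refine Real.log_le_log (regretOJ_sup_pos n hx) (Finset.sup'_le _ _ fun j hj => ?_)
  obtain ⟨k, rfl⟩ := Nat.exists_eq_add_of_le (Finset.mem_range_succ_iff.1 hj)
  have h := pi_mul_pow_mul_pow_mul_factorial_le hx.1 (sub_nonneg.2 hx.2) (by ring) j k
  rw [Real.Gamma_nat_eq_factorial, Nat.add_sub_cancel_left,
    show ((j + k : ℕ) : ℝ) - j = k by push_cast; ring]
  have hj : 0 < Real.Gamma ((j : ℝ) + 1 / 2) := Real.Gamma_pos_of_pos (by positivity)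
  have hk : 0 < Real.Gamma ((k : ℝ) + 1 / 2) := Real.Gamma_pos_of_pos (by positivity)
  exact (div_le_iff₀ (by positivity)).2 h

/-- Here `t` is the set of rounds in which the second stock is picked. The dependence on `x` is only
through `t.card`, which reduces Beta integrals of the wealth to moments. -/
theorem constWealth_eq_sum (n : ℕ) (x : ℝ) : constWealth E₁ E₂ n ω x =
    ∑ t ∈ (Finset.Icc 1 n).powerset, ((∏ i ∈ t, E₂ i ω) * ∏ i ∈ Finset.Icc 1 n \ t, E₁ i ω) *
      (x ^ t.card * (1 - x) ^ (n - t.card)) := by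
  rw [constWealth]
  simp_rw [add_comm ((1 - x) * _)]
  rw [Finset.prod_add]
  refine Finset.sum_congr rfl fun t ht => ?_
  rw [Finset.prod_mul_distrib, Finset.prod_mul_distrib, Finset.prod_const, Finset.prod_const,
    Finset.card_sdiff_of_subset (Finset.mem_powerset.1 ht), Nat.card_Icc, Nat.add_sub_cancel]
  ring

theorem prod_nonneg_of_subset_Icc {f : ℕ → ℝ} (hf : ∀ n, 0 ≤ f (n + 1)) {n : ℕ} {t : Finset ℕ}
    (ht : t ⊆ Finset.Icc 1 n) : 0 ≤ ∏ i ∈ t, f i := by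
  refine Finset.prod_nonneg fun i hi => ?_
  obtain ⟨k, rfl⟩ := Nat.exists_eq_add_of_le' (Finset.mem_Icc.1 (ht hi)).1
  exact hf k

/-- The Orabona–Jun regret bound. -/
theorem expLogSub_regretOJ_le_wealthUP (h₁ : ∀ n, 0 ≤ E₁ (n + 1) ω) (h₂ : ∀ n, 0 ≤ E₂ (n + 1) ω)
    (n : ℕ) {x : ℝ} (hx : x ∈ Set.Icc (0 : ℝ) 1) :
    expLogSub (constWealth E₁ E₂ n ω x) (regretOJ n x) ≤ wealthUP E₁ E₂ n ω := by
  have hpos := regretOJ_sup_pos n hx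
  rw [expLogSub_regretOJ _ n hx, div_le_iff₀ hpos, wealthUP_eq_integral h₁ h₂]
  simp_rw [constWealth_eq_sum]
  rw [integral_finsetSum _ fun t _ =>
    integrable_betaMeasure_of_continuous (by norm_num) (by norm_num) (by fun_prop), Finset.sum_mul]
  -- The comparison is term by term: the coefficients are nonnegative, and the ratio of the monomial
  -- to its Beta mean is the `t.card`-th entry of the maximum.
  refine Finset.sum_le_sum fun t ht => ?_
  have ht' := Finset.mem_powerset.1 ht
  have hcard : t.card ≤ n := by simpa using Finset.card_le_card ht'
  rw [integral_const_mul]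
  refine (mul_le_mul_of_nonneg_left ?_ (mul_nonneg
    (prod_nonneg_of_subset_Icc (f := fun i => E₂ i ω) h₂ ht')
    (prod_nonneg_of_subset_Icc (f := fun i => E₁ i ω) h₁ Finset.sdiff_subset))).trans_eq
    (mul_assoc _ _ _).symm
  have hsup := Finset.le_sup' (fun j : ℕ =>
    Real.pi * x ^ j * (1 - x) ^ (n - j) * Real.Gamma ((n : ℝ) + 1) /
      (Real.Gamma ((j : ℝ) + 1 / 2) * Real.Gamma ((n : ℝ) - (j : ℝ) + 1 / 2)))
    (Finset.mem_range_succ_iff.2 hcard)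
  obtain ⟨k, hk⟩ := Nat.exists_eq_add_of_le hcard
  have hΓj : 0 < Real.Gamma ((t.card : ℝ) + 1 / 2) := Real.Gamma_pos_of_pos (by positivity)
  have hΓk : 0 < Real.Gamma ((k : ℝ) + 1 / 2) := Real.Gamma_pos_of_pos (by positivity)
  have hsub : n - t.card = k := by omega
  have hsub' : (n : ℝ) - t.card = k := by rw [hk]; push_cast; ring
  rw [hsub, integral_betaMeasure_half_pow_mul_pow, ← hk]
  simp only [hsub, hsub', Real.Gamma_nat_eq_factorial] at hsup
  rw [div_le_iff₀ (by positivity)] at hsup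
  have hπ := Real.pi_pos
  rw [div_mul_eq_mul_div, le_div_iff₀ (by positivity)]
  simp only [Real.Gamma_nat_eq_factorial]
  refine (le_of_eq ?_).trans (hsup.trans_eq ?_) <;> ring

theorem wealthUP_le_of_forall_le (h₁ : ∀ n, 0 ≤ E₁ (n + 1) ω) (h₂ : ∀ n, 0 ≤ E₂ (n + 1) ω)
    (n : ℕ) {C : ℝ} (hC : ∀ x ∈ Set.Icc (0 : ℝ) 1, constWealth E₁ E₂ n ω x ≤ C) :
    wealthUP E₁ E₂ n ω ≤ C := by
  have := isProbabilityMeasureBeta (α := 1 / 2) (β := 1 / 2) (by norm_num) (by norm_num)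
  rw [wealthUP_eq_integral h₁ h₂]
  have : ∫ _, C ∂(betaMeasure (1 / 2) (1 / 2)) = C := by
    rw [integral_const, probReal_univ, one_smul]
  rw [← this]
  refine integral_mono_ae
      (integrable_betaMeasure_of_continuous (by norm_num) (by norm_num) (by fun_prop))
      (integrable_const _) ?_
  filter_upwards [betaMeasure_ae_mem_Ioo _ _] with x hx using hC x ⟨hx.1.le, hx.2.le⟩

/-- The three wealth processes are ordered and within a factor `2 * √(n + 1)` of the best constant
strategy. -/
theorem wealth_sandwich (h₁ : ∀ n, 0 ≤ E₁ (n + 1) ω) (h₂ : ∀ n, 0 ≤ E₂ (n + 1) ω)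
    {lmax : ℕ → Ω → ℝ} (n : ℕ) (hmem : lmax n ω ∈ Set.Icc (0 : ℝ) 1)
    (hmax : ∀ x ∈ Set.Icc (0 : ℝ) 1, constWealth E₁ E₂ n ω x ≤ constWealth E₁ E₂ n ω (lmax n ω)) :
    0 ≤ wealthCO E₁ E₂ lmax n ω ∧
    wealthCO E₁ E₂ lmax n ω ≤ wealthOJ E₁ E₂ lmax n ω ∧
    wealthOJ E₁ E₂ lmax n ω ≤ wealthUP E₁ E₂ n ω ∧
    wealthUP E₁ E₂ n ω ≤ 2 * √((n : ℝ) + 1) * wealthCO E₁ E₂ lmax n ω ∧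
    ∀ x ∈ Set.Icc (0 : ℝ) 1,
      constWealth E₁ E₂ n ω x ≤ 2 * √((n : ℝ) + 1) * wealthCO E₁ E₂ lmax n ω := by
  have h0 := constWealth_nonneg h₁ h₂ n hmem
  have hCO : 2 * √((n : ℝ) + 1) * wealthCO E₁ E₂ lmax n ω = constWealth E₁ E₂ n ω (lmax n ω) := by
    rw [wealthCO, expLogSub_regretCO]; field_simp
  refine ⟨mul_nonneg h0 (Real.exp_pos _).le, ?_, expLogSub_regretOJ_le_wealthUP h₁ h₂ n hmem, ?_, ?_⟩
  · refine mul_le_mul_of_nonneg_left (Real.exp_le_exp.2 ?_) h0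
    linarith [regretOJ_le_regretCO n hmem]
  · rw [hCO]; exact wealthUP_le_of_forall_le h₁ h₂ n hmax
  · rw [hCO]; exact hmax

end

section

variable {Ω : Type*} {m : MeasurableSpace Ω} {ℱ : Filtration ℕ m} {E₁ E₂ : ℕ → Ω → ℝ}
  {P : Measure Ω}

/-! ### Products of bets on i.i.d. pairs -/

theorem IIDPairs.ae_nonneg (hP : IIDPairs ℱ E₁ E₂ P) (h₁ : ∀ᵐ ω ∂P, 0 ≤ E₁ 1 ω)
    (h₂ : ∀ᵐ ω ∂P, 0 ≤ E₂ 1 ω) :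
    ∀ᵐ ω ∂P, (∀ n, 0 ≤ E₁ (n + 1) ω) ∧ ∀ n, 0 ≤ E₂ (n + 1) ω := by
  have h : ∀ n, ∀ᵐ ω ∂P, (E₁ (n + 1) ω, E₂ (n + 1) ω) ∈ Set.Ici (0 : ℝ) ×ˢ Set.Ici (0 : ℝ) :=
    fun n => (hP n).1.symm.ae_mem_snd (measurableSet_Ici.prod measurableSet_Ici)
      (by filter_upwards [h₁, h₂] with ω h h' using ⟨h, h'⟩)
  filter_upwards [ae_all_iff.2 h] with ω hω using ⟨fun n => (hω n).1, fun n => (hω n).2⟩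

/-- The product over the rounds `1, …, n` of the `l`-weighted averages of the payoffs `g₁` and `g₂` of
the pair. -/
def betProduct (E₁ E₂ : ℕ → Ω → ℝ) (l : ℕ → Ω → ℝ) (g₁ g₂ : ℝ × ℝ → ENNReal) (n : ℕ) (ω : Ω) :
    ENNReal :=
  ∏ i ∈ Finset.Icc 1 n, (ENNReal.ofReal (1 - l i ω) * g₁ (E₁ i ω, E₂ i ω) +
    ENNReal.ofReal (l i ω) * g₂ (E₁ i ω, E₂ i ω))

theorem measurable_betProduct (hE₁ : ∀ n : ℕ, 1 ≤ n → Measurable[ℱ n] (E₁ n))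
    (hE₂ : ∀ n : ℕ, 1 ≤ n → Measurable[ℱ n] (E₂ n)) {l : ℕ → Ω → ℝ} (hl : IsStrategy ℱ l)
    {g₁ g₂ : ℝ × ℝ → ENNReal} (hg₁ : Measurable g₁) (hg₂ : Measurable g₂) (n : ℕ) :
    Measurable[ℱ n] (betProduct E₁ E₂ l g₁ g₂ n) := by
  refine Finset.measurable_fun_prod (Finset.Icc 1 n) fun i hi => ?_
  obtain ⟨hi1, hin⟩ := Finset.mem_Icc.1 hi
  obtain ⟨k, rfl⟩ := Nat.exists_eq_add_of_le' hi1
  have h1 : Measurable[ℱ n] (E₁ (k + 1)) := (hE₁ _ hi1).mono (ℱ.mono hin) le_rfl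
  have h2 : Measurable[ℱ n] (E₂ (k + 1)) := (hE₂ _ hi1).mono (ℱ.mono hin) le_rfl
  have h3 : Measurable[ℱ n] (l (k + 1)) := (hl k).1.mono (ℱ.mono (by omega)) le_rfl
  have h4 := h1.prodMk h2
  exact ((measurable_const.sub h3).ennreal_ofReal.mul (hg₁.comp h4)).add
    (h3.ennreal_ofReal.mul (hg₂.comp h4))

/-- Given `ℱ n`, the new factor is a convex combination, with known weights, of two payoffs
independent of the past with mean at most `C`. The choice `C = 1` serves the supermartingale
property, `C = 1 + ε` the growth bound. -/
theorem setLIntegral_betProduct_succ_le (hE₁ : ∀ n : ℕ, 1 ≤ n → Measurable[ℱ n] (E₁ n))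
    (hE₂ : ∀ n : ℕ, 1 ≤ n → Measurable[ℱ n] (E₂ n)) {l : ℕ → Ω → ℝ} (hl : IsStrategy ℱ l)
    {g₁ g₂ : ℝ × ℝ → ENNReal} (hg₁ : Measurable g₁) (hg₂ : Measurable g₂)
    (hP : IIDPairs ℱ E₁ E₂ P) {C : ENNReal} (hC₁ : ∫⁻ ω, g₁ (E₁ 1 ω, E₂ 1 ω) ∂P ≤ C)
    (hC₂ : ∫⁻ ω, g₂ (E₁ 1 ω, E₂ 1 ω) ∂P ≤ C) (n : ℕ) {s : Set Ω} (hs : MeasurableSet[ℱ n] s) :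
    ∫⁻ ω in s, betProduct E₁ E₂ l g₁ g₂ (n + 1) ω ∂P ≤
      C * ∫⁻ ω in s, betProduct E₁ E₂ l g₁ g₂ n ω ∂P := by
  set Z : Ω → ENNReal := s.indicator (betProduct E₁ E₂ l g₁ g₂ n) with hZ
  have hZm : Measurable[ℱ n] Z := (measurable_betProduct hE₁ hE₂ hl hg₁ hg₂ n).indicator hs
  set p : Ω → ℝ × ℝ := fun ω => (E₁ (n + 1) ω, E₂ (n + 1) ω) with hp
  have hpm : Measurable p := ((hE₁ _ (by omega)).mono (ℱ.le _) le_rfl).prodMk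
    ((hE₂ _ (by omega)).mono (ℱ.le _) le_rfl)
  have hpc : Measurable[MeasurableSpace.comap p inferInstance] p := comap_measurable p
  have hone : ∀ {a : Ω → ENNReal}, Measurable[ℱ n] a → ∀ {g : ℝ × ℝ → ENNReal}, Measurable g →
      ∫⁻ ω, g (E₁ 1 ω, E₂ 1 ω) ∂P ≤ C → ∫⁻ ω, a ω * g (p ω) ∂P ≤ (∫⁻ ω, a ω ∂P) * C := by
    intro a ha g hg hgC
    refine (lintegral_mul_eq_lintegral_mul_lintegral_of_independent_measurableSpace (ℱ.le n)
      hpm.comap_le (hP n).2 ha (hg.comp hpc)).trans_le ?_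
    gcongr
    exact (((hP n).1.comp hg).lintegral_eq).trans_le hgC
  have hl1 : Measurable[ℱ n] fun ω => Z ω * ENNReal.ofReal (1 - l (n + 1) ω) :=
    hZm.mul (measurable_const.sub (hl n).1).ennreal_ofReal
  have hl2 : Measurable[ℱ n] fun ω => Z ω * ENNReal.ofReal (l (n + 1) ω) :=
    hZm.mul (hl n).1.ennreal_ofReal
  have hs' := ℱ.le n s hs
  rw [← lintegral_indicator hs', ← lintegral_indicator hs']
  calc ∫⁻ ω, s.indicator (betProduct E₁ E₂ l g₁ g₂ (n + 1)) ω ∂P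
      = ∫⁻ ω, (Z ω * ENNReal.ofReal (1 - l (n + 1) ω) * g₁ (p ω) +
          Z ω * ENNReal.ofReal (l (n + 1) ω) * g₂ (p ω)) ∂P := by
        refine lintegral_congr fun ω => ?_
        by_cases h : ω ∈ s
        · simp only [hZ, Set.indicator_of_mem h, betProduct, prod_Icc_one_succ, hp]; ring
        · simp [hZ, h]
    _ = ∫⁻ ω, Z ω * ENNReal.ofReal (1 - l (n + 1) ω) * g₁ (p ω) ∂P +
          ∫⁻ ω, Z ω * ENNReal.ofReal (l (n + 1) ω) * g₂ (p ω) ∂P :=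
        lintegral_add_left ((hl1.mono (ℱ.le n) le_rfl).mul (hg₁.comp hpm)) _
    _ ≤ (∫⁻ ω, Z ω * ENNReal.ofReal (1 - l (n + 1) ω) ∂P) * C +
          (∫⁻ ω, Z ω * ENNReal.ofReal (l (n + 1) ω) ∂P) * C :=
        add_le_add (hone hl1 hg₁ hC₁) (hone hl2 hg₂ hC₂)
    _ = (∫⁻ ω, (Z ω * ENNReal.ofReal (1 - l (n + 1) ω) +
          Z ω * ENNReal.ofReal (l (n + 1) ω)) ∂P) * C := by
        rw [lintegral_add_left (hl1.mono (ℱ.le n) le_rfl), add_mul]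
    _ = C * ∫⁻ ω, Z ω ∂P := by
        rw [mul_comm]
        congr 1
        refine lintegral_congr fun ω => ?_
        obtain ⟨h0, h1⟩ := (hl n).2 ω
        rw [← mul_add, ← ENNReal.ofReal_add (sub_nonneg.2 h1) h0, sub_add_cancel,
          ENNReal.ofReal_one, mul_one]

theorem lintegral_betProduct_le [IsProbabilityMeasure P]
    (hE₁ : ∀ n : ℕ, 1 ≤ n → Measurable[ℱ n] (E₁ n))
    (hE₂ : ∀ n : ℕ, 1 ≤ n → Measurable[ℱ n] (E₂ n)) {l : ℕ → Ω → ℝ} (hl : IsStrategy ℱ l)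
    {g₁ g₂ : ℝ × ℝ → ENNReal} (hg₁ : Measurable g₁) (hg₂ : Measurable g₂)
    (hP : IIDPairs ℱ E₁ E₂ P) {C : ENNReal} (hC₁ : ∫⁻ ω, g₁ (E₁ 1 ω, E₂ 1 ω) ∂P ≤ C)
    (hC₂ : ∫⁻ ω, g₂ (E₁ 1 ω, E₂ 1 ω) ∂P ≤ C) (n : ℕ) :
    ∫⁻ ω, betProduct E₁ E₂ l g₁ g₂ n ω ∂P ≤ C ^ n := by
  induction n with
  | zero => simp [betProduct]
  | succ n ih =>
    have h := setLIntegral_betProduct_succ_le hE₁ hE₂ hl hg₁ hg₂ hP hC₁ hC₂ n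
      MeasurableSet.univ
    rw [Measure.restrict_univ] at h
    exact h.trans (by rw [pow_succ']; gcongr)

theorem measurable_wealth (hE₁ : ∀ n : ℕ, 1 ≤ n → Measurable[ℱ n] (E₁ n))
    (hE₂ : ∀ n : ℕ, 1 ≤ n → Measurable[ℱ n] (E₂ n)) {l : ℕ → Ω → ℝ}
    (hl : ∀ n, Measurable[ℱ n] (l (n + 1))) (n : ℕ) :
    Measurable[ℱ n] (wealth E₁ E₂ l n) := by
  refine Finset.measurable_fun_prod (Finset.Icc 1 n) fun i hi => ?_
  obtain ⟨hi1, hin⟩ := Finset.mem_Icc.1 hi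
  obtain ⟨k, rfl⟩ := Nat.exists_eq_add_of_le' hi1
  have h1 : Measurable[ℱ n] (E₁ (k + 1)) := (hE₁ _ hi1).mono (ℱ.mono hin) le_rfl
  have h2 : Measurable[ℱ n] (E₂ (k + 1)) := (hE₂ _ hi1).mono (ℱ.mono hin) le_rfl
  have h3 : Measurable[ℱ n] (l (k + 1)) := (hl k).mono (ℱ.mono (by omega)) le_rfl
  exact ((measurable_const.sub h3).mul h1).add (h3.mul h2)

theorem ofReal_wealth_eq_betProduct {l : ℕ → Ω → ℝ} {ω : Ω}
    (hl : ∀ n, l (n + 1) ω ∈ Set.Icc (0 : ℝ) 1)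
    (h₁ : ∀ n, 0 ≤ E₁ (n + 1) ω) (h₂ : ∀ n, 0 ≤ E₂ (n + 1) ω) (n : ℕ) :
    ENNReal.ofReal (wealth E₁ E₂ l n ω) = betProduct E₁ E₂ l
      (fun e => ENNReal.ofReal e.1) (fun e => ENNReal.ofReal e.2) n ω := by
  induction n with
  | zero => simp [wealth, betProduct]
  | succ n ih =>
    have h1 : 0 ≤ 1 - l (n + 1) ω := sub_nonneg.2 (hl n).2
    have h2 := (hl n).1
    rw [wealth_succ, ENNReal.ofReal_mul (wealth_nonneg hl h₁ h₂ n), ih, betProduct, betProduct,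
      prod_Icc_one_succ, ENNReal.ofReal_add (mul_nonneg h1 (h₁ n)) (mul_nonneg h2 (h₂ n)),
      ENNReal.ofReal_mul h1, ENNReal.ofReal_mul h2]

/-- Under the null, the wealth of a betting strategy is a test supermartingale. -/
theorem isTestSupermartingale_wealth (hE₁ : ∀ n : ℕ, 1 ≤ n → Measurable[ℱ n] (E₁ n))
    (hE₂ : ∀ n : ℕ, 1 ≤ n → Measurable[ℱ n] (E₂ n)) {l : ℕ → Ω → ℝ} (hl : IsStrategy ℱ l)
    (hP : P ∈ nullHypothesis ℱ E₁ E₂) : IsTestSupermartingale ℱ P (wealth E₁ E₂ l) := by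
  obtain ⟨hprob, hiid, ⟨hn₁, hi₁⟩, ⟨hn₂, hi₂⟩⟩ := hP
  have hg₁ : Measurable fun e : ℝ × ℝ => ENNReal.ofReal e.1 := measurable_fst.ennreal_ofReal
  have hg₂ : Measurable fun e : ℝ × ℝ => ENNReal.ofReal e.2 := measurable_snd.ennreal_ofReal
  have hnn := hiid.ae_nonneg hn₁ hn₂
  have hmeas := measurable_wealth hE₁ hE₂ (fun n => (hl n).1)
  have hae : ∀ n, (fun ω => ENNReal.ofReal (wealth E₁ E₂ l n ω)) =ᵐ[P] betProduct E₁ E₂ l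
      (fun e => ENNReal.ofReal e.1) (fun e => ENNReal.ofReal e.2) n := fun n => by
    filter_upwards [hnn] with ω hω
    exact ofReal_wealth_eq_betProduct (fun n => (hl n).2 ω) hω.1 hω.2 n
  have hpos : ∀ n, ∀ᵐ ω ∂P, 0 ≤ wealth E₁ E₂ l n ω := fun n => by
    filter_upwards [hnn] with ω hω
    exact wealth_nonneg (fun n => (hl n).2 ω) hω.1 hω.2 n
  have hle : ∀ n, ∫⁻ ω, ENNReal.ofReal (wealth E₁ E₂ l n ω) ∂P ≤ 1 := fun n => by
    rw [lintegral_congr_ae (hae n)]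
    exact (lintegral_betProduct_le hE₁ hE₂ hl hg₁ hg₂ hiid hi₁ hi₂ n).trans_eq (one_pow n)
  have hasm : ∀ n, AEStronglyMeasurable (wealth E₁ E₂ l n) P := fun n =>
    ((hmeas n).mono (ℱ.le n) le_rfl).aestronglyMeasurable
  have hint : ∀ n, Integrable (wealth E₁ E₂ l n) P := fun n =>
    (lintegral_ofReal_ne_top_iff_integrable (hasm n) (hpos n)).1
      (ne_top_of_le_ne_top ENNReal.one_ne_top (hle n))
  refine ⟨supermartingale_of_setIntegral_succ_le (fun n => (hmeas n).stronglyMeasurable) hint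
    fun n s hs => ?_, hpos, ?_⟩
  · rw [integral_eq_lintegral_of_nonneg_ae (ae_restrict_of_ae (hpos _)) (hasm _).restrict,
      integral_eq_lintegral_of_nonneg_ae (ae_restrict_of_ae (hpos _)) (hasm _).restrict]
    refine ENNReal.toReal_mono ?_ ?_
    · exact ne_top_of_le_ne_top ENNReal.one_ne_top ((setLIntegral_le_lintegral _ _).trans (hle n))
    · rw [lintegral_congr_ae (ae_restrict_of_ae (hae n)),
        lintegral_congr_ae (ae_restrict_of_ae (hae (n + 1)))]
      exact (setLIntegral_betProduct_succ_le hE₁ hE₂ hl hg₁ hg₂ hiid hi₁ hi₂ n hs).trans_eq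
        (one_mul _)
  · rw [integral_eq_lintegral_of_nonneg_ae (hpos _) (hasm _)]
    exact ENNReal.toReal_le_of_le_ofReal zero_le_one ((hle 1).trans_eq ENNReal.ofReal_one.symm)

/-! ### Existence of a nearly log-optimal constant strategy -/

/-- If `a = b = 0` the ratios are `0 / 0 = 0`, which is why the last relation is only an inequality.
-/
theorem div_mix_bounds {a b x δ : ℝ} (ha : 0 ≤ a) (hb : 0 ≤ b) (hδ : 0 < δ) (hx : δ ≤ x)
    (hx' : x ≤ 1 - δ) :
    0 ≤ a / ((1 - x) * a + x * b) ∧ a / ((1 - x) * a + x * b) ≤ 1 / (1 - x) ∧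
    0 ≤ b / ((1 - x) * a + x * b) ∧ b / ((1 - x) * a + x * b) ≤ 1 / x ∧
    (1 - x) * (a / ((1 - x) * a + x * b)) + x * (b / ((1 - x) * a + x * b)) ≤ 1 := by
  have h0 : 0 < x := by linarith
  have h1 : 0 < 1 - x := by linarith
  have hD : 0 ≤ (1 - x) * a + x * b := by positivity
  refine ⟨by positivity, ?_, by positivity, ?_, ?_⟩
  · rw [le_div_iff₀ h1, div_mul_eq_mul_div]
    exact div_le_one_of_le₀ (by nlinarith [mul_nonneg h0.le hb]) hD
  · rw [le_div_iff₀ h0, div_mul_eq_mul_div]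
    exact div_le_one_of_le₀ (by nlinarith [mul_nonneg h1.le ha]) hD
  · rw [← mul_div_assoc, ← mul_div_assoc, ← add_div]
    exact div_self_le_one _

theorem continuousOn_div_mix {a b δ : ℝ} (ha : 0 ≤ a) (hb : 0 ≤ b) (hδ : 0 < δ) {c : ℝ}
    (hc : a = 0 → b = 0 → c = 0) :
    ContinuousOn (fun x => c / ((1 - x) * a + x * b)) (Set.Icc δ (1 - δ)) := by
  by_cases h : a = 0 ∧ b = 0
  · simp only [hc h.1 h.2, zero_div]; exact continuousOn_const
  · refine continuousOn_const.div (by fun_prop) fun x hx => ?_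
    have h0 : 0 < x := hδ.trans_le hx.1
    have h1 : 0 < 1 - x := by linarith [hx.2]
    intro hD
    have h2 := mul_nonneg h1.le ha
    have h3 := mul_nonneg h0.le hb
    have h4 : (1 - x) * a = 0 := by linarith
    have h5 : x * b = 0 := by linarith
    exact h ⟨(mul_eq_zero.1 h4).resolve_left h1.ne', (mul_eq_zero.1 h5).resolve_left h0.ne'⟩

/-- There are constant strategies relative to which both stocks have expectation arbitrarily close to
one. -/
theorem exists_near_numeraire [IsProbabilityMeasure P] {X Y : Ω → ℝ} (hX : Measurable X)
    (hY : Measurable Y) (hX0 : ∀ᵐ ω ∂P, 0 ≤ X ω) (hY0 : ∀ᵐ ω ∂P, 0 ≤ Y ω) {ε : ℝ} (hε : 0 < ε)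
    (hε1 : ε ≤ 1) : ∃ x ∈ Set.Ioo (0 : ℝ) 1,
    ∫⁻ ω, ENNReal.ofReal (X ω / ((1 - x) * X ω + x * Y ω)) ∂P ≤ ENNReal.ofReal (1 + ε) ∧
    ∫⁻ ω, ENNReal.ofReal (Y ω / ((1 - x) * X ω + x * Y ω)) ∂P ≤ ENNReal.ofReal (1 + ε) := by
  -- Chosen so that `1 / (1 - δ) = 1 + ε`: the pointwise bounds `1 / (1 - x)` at `x = δ` and `1 / x`
  -- at `x = 1 - δ` are then already good enough.
  set δ : ℝ := ε / (1 + ε) with hδ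
  have hδ0 : 0 < δ := by positivity
  have hδ2 : δ ≤ 1 - δ := by
    have : δ ≤ 1 / 2 := by rw [hδ, div_le_div_iff₀ (by positivity) (by norm_num)]; linarith
    linarith
  have hinv : 1 / (1 - δ) = 1 + ε := by rw [hδ]; field_simp; ring
  have hb : ∀ x ∈ Set.Icc δ (1 - δ), ∀ᵐ ω ∂P,
      0 ≤ X ω / ((1 - x) * X ω + x * Y ω) ∧
      X ω / ((1 - x) * X ω + x * Y ω) ≤ 1 / (1 - x) ∧
      0 ≤ Y ω / ((1 - x) * X ω + x * Y ω) ∧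
      Y ω / ((1 - x) * X ω + x * Y ω) ≤ 1 / x ∧
      (1 - x) * (X ω / ((1 - x) * X ω + x * Y ω)) + x * (Y ω / ((1 - x) * X ω + x * Y ω)) ≤ 1 :=
    fun x hx => by
      filter_upwards [hX0, hY0] with ω h h' using div_mix_bounds h h' hδ0 hx.1 hx.2
  have hmX : ∀ x : ℝ, Measurable fun ω => X ω / ((1 - x) * X ω + x * Y ω) := fun x => by fun_prop
  have hmY : ∀ x : ℝ, Measurable fun ω => Y ω / ((1 - x) * X ω + x * Y ω) := fun x => by fun_prop
  have hbX : ∀ x ∈ Set.Icc δ (1 - δ), ∀ᵐ ω ∂P, ‖X ω / ((1 - x) * X ω + x * Y ω)‖ ≤ 1 / δ :=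
    fun x hx => by
      filter_upwards [hb x hx] with ω h
      rw [Real.norm_of_nonneg h.1]
      exact h.2.1.trans (one_div_le_one_div_of_le hδ0 (by linarith [hx.2]))
  have hbY : ∀ x ∈ Set.Icc δ (1 - δ), ∀ᵐ ω ∂P, ‖Y ω / ((1 - x) * X ω + x * Y ω)‖ ≤ 1 / δ :=
    fun x hx => by
      filter_upwards [hb x hx] with ω h
      rw [Real.norm_of_nonneg h.2.2.1]
      exact h.2.2.2.1.trans (one_div_le_one_div_of_le hδ0 hx.1)
  have hiX : ∀ x ∈ Set.Icc δ (1 - δ), Integrable (fun ω => X ω / ((1 - x) * X ω + x * Y ω)) P :=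
    fun x hx => Integrable.of_bound (hmX x).aestronglyMeasurable _ (hbX x hx)
  have hiY : ∀ x ∈ Set.Icc δ (1 - δ), Integrable (fun ω => Y ω / ((1 - x) * X ω + x * Y ω)) P :=
    fun x hx => Integrable.of_bound (hmY x).aestronglyMeasurable _ (hbY x hx)
  set f : ℝ → ℝ := fun x => ∫ ω, X ω / ((1 - x) * X ω + x * Y ω) ∂P with hf
  set g : ℝ → ℝ := fun x => ∫ ω, Y ω / ((1 - x) * X ω + x * Y ω) ∂P with hg
  have hfc : ContinuousOn f (Set.Icc δ (1 - δ)) :=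
    continuousOn_of_dominated (fun x _ => (hmX x).aestronglyMeasurable) hbX (integrable_const _)
      (by filter_upwards [hX0, hY0] with ω h h'
          using continuousOn_div_mix h h' hδ0 fun h _ => h)
  have hgc : ContinuousOn g (Set.Icc δ (1 - δ)) :=
    continuousOn_of_dominated (fun x _ => (hmY x).aestronglyMeasurable) hbY (integrable_const _)
      (by filter_upwards [hX0, hY0] with ω h h'
          using continuousOn_div_mix h h' hδ0 fun _ h => h)
  have hmix : ∀ x ∈ Set.Icc δ (1 - δ), (1 - x) * f x + x * g x ≤ 1 := fun x hx => by
    simp only [hf, hg]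
    rw [← integral_const_mul, ← integral_const_mul,
      ← integral_add ((hiX x hx).const_mul _) ((hiY x hx).const_mul _)]
    refine (integral_mono_ae (((hiX x hx).const_mul _).add ((hiY x hx).const_mul _))
      (integrable_const 1) ?_).trans_eq (by simp)
    filter_upwards [hb x hx] with ω h using h.2.2.2.2
  have hconst : ∀ {h : Ω → ℝ} {c : ℝ}, Integrable h P → (∀ᵐ ω ∂P, h ω ≤ c) → ∫ ω, h ω ∂P ≤ c :=
    fun {h c} hi hc => (integral_mono_ae hi (integrable_const c) hc).trans_eq (by simp)
  suffices h : ∃ x ∈ Set.Icc δ (1 - δ), f x ≤ 1 + ε ∧ g x ≤ 1 + ε by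
    obtain ⟨x, hx, hfx, hgx⟩ := h
    refine ⟨x, ⟨by linarith [hx.1], by linarith [hx.2]⟩, ?_, ?_⟩
    · rw [← ofReal_integral_eq_lintegral_ofReal (hiX x hx)
        (by filter_upwards [hb x hx] with ω h using h.1)]
      exact ENNReal.ofReal_le_ofReal hfx
    · rw [← ofReal_integral_eq_lintegral_ofReal (hiY x hx)
        (by filter_upwards [hb x hx] with ω h using h.2.2.1)]
      exact ENNReal.ofReal_le_ofReal hgx
  have hl : δ ∈ Set.Icc δ (1 - δ) := ⟨le_rfl, hδ2⟩
  have hr : 1 - δ ∈ Set.Icc δ (1 - δ) := ⟨hδ2, le_rfl⟩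
  -- Since a convex combination of `f` and `g` is at most one, so is the smaller of the two. At an
  -- endpoint with the favourable order the larger is bounded pointwise by `1 + ε`; otherwise `g -
  -- f` changes sign, and at a zero both are at most one.
  rcases le_total (f (1 - δ)) (g (1 - δ)) with hle | hle
  · refine ⟨1 - δ, hr, ?_, ?_⟩
    · have := hmix _ hr
      nlinarith
    · refine (hconst (hiY _ hr) ?_).trans_eq hinv
      filter_upwards [hb _ hr] with ω h using h.2.2.2.1
  rcases le_total (g δ) (f δ) with hle' | hle'
  · refine ⟨δ, hl, ?_, ?_⟩
    · refine (hconst (hiX _ hl) ?_).trans_eq hinv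
      filter_upwards [hb _ hl] with ω h using h.2.1
    · have := hmix _ hl
      nlinarith
  · obtain ⟨x, hx, hx0⟩ := intermediate_value_Icc' hδ2 (hgc.sub hfc)
      (show (0 : ℝ) ∈ Set.Icc _ _ from ⟨sub_nonpos.2 hle, sub_nonneg.2 hle'⟩)
    have hfg : g x = f x := sub_eq_zero.1 hx0
    have := hmix x hx
    rw [hfg] at this
    exact ⟨x, hx, by linarith, by rw [hfg]; linarith⟩

end

section

variable {Ω : Type*} {m : MeasurableSpace Ω} {ℱ : Filtration ℕ m} {E₁ E₂ : ℕ → Ω → ℝ}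
  {P Q : Measure Ω} {𝒬 : Set (Measure Ω)} {lmax : ℕ → Ω → ℝ}

/-! ### Growth of arbitrary strategies against constant strategies -/

/-- A product form of the relative wealth that survives zero factors: for interior `x` the mixture
vanishes only if both stocks do, and then every strategy has factor zero. -/
theorem ofReal_wealth_eq_betProduct_mul_constWealth {l : ℕ → Ω → ℝ} {ω : Ω} {x : ℝ}
    (hx : x ∈ Set.Ioo (0 : ℝ) 1) (hl : ∀ n, l (n + 1) ω ∈ Set.Icc (0 : ℝ) 1)
    (h₁ : ∀ n, 0 ≤ E₁ (n + 1) ω) (h₂ : ∀ n, 0 ≤ E₂ (n + 1) ω) (n : ℕ) :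
    ENNReal.ofReal (wealth E₁ E₂ l n ω) = betProduct E₁ E₂ l
      (fun e => ENNReal.ofReal (e.1 / ((1 - x) * e.1 + x * e.2)))
      (fun e => ENNReal.ofReal (e.2 / ((1 - x) * e.1 + x * e.2))) n ω *
        ENNReal.ofReal (constWealth E₁ E₂ n ω x) := by
  induction n with
  | zero => simp [wealth, betProduct, constWealth]
  | succ n ih =>
    have hl1 : 0 ≤ 1 - l (n + 1) ω := sub_nonneg.2 (hl n).2
    have hl0 := (hl n).1
    have hx0 := hx.1
    have hx1 : 0 < 1 - x := sub_pos.2 hx.2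
    rw [wealth_succ, ENNReal.ofReal_mul (wealth_nonneg hl h₁ h₂ n), ih, betProduct, betProduct,
      prod_Icc_one_succ, constWealth_succ,
      ENNReal.ofReal_mul (constWealth_nonneg h₁ h₂ n ⟨hx.1.le, hx.2.le⟩)]
    generalize E₁ (n + 1) ω = a, E₂ (n + 1) ω = b, h₁ n = ha, h₂ n = hb
    have hD : 0 ≤ (1 - x) * a + x * b := by positivity
    have hfac : ENNReal.ofReal ((1 - l (n + 1) ω) * a + l (n + 1) ω * b) =
        (ENNReal.ofReal (1 - l (n + 1) ω) * ENNReal.ofReal (a / ((1 - x) * a + x * b)) +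
          ENNReal.ofReal (l (n + 1) ω) * ENNReal.ofReal (b / ((1 - x) * a + x * b))) *
            ENNReal.ofReal ((1 - x) * a + x * b) := by
      rw [← ENNReal.ofReal_mul hl1, ← ENNReal.ofReal_mul hl0,
        ← ENNReal.ofReal_add (by positivity) (by positivity), ← ENNReal.ofReal_mul (by positivity)]
      congr 1
      rcases eq_or_ne ((1 - x) * a + x * b) 0 with h | h
      · have h1 := mul_nonneg hx1.le ha
        have h2 := mul_nonneg hx0.le hb
        have ha0 : a = 0 := (mul_eq_zero.1 (by linarith : (1 - x) * a = 0)).resolve_left hx1.ne'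
        have hb0 : b = 0 := (mul_eq_zero.1 (by linarith : x * b = 0)).resolve_left hx0.ne'
        simp [ha0, hb0]
      · rw [← mul_div_assoc, ← mul_div_assoc, ← add_div, div_mul_cancel₀ _ h]
    rw [hfac]; ring

/-- No strategy outgrows exponentially a suitable constant strategy. -/
theorem exists_const_wealth_growth [IsProbabilityMeasure Q]
    (hE₁ : ∀ n : ℕ, 1 ≤ n → Measurable[ℱ n] (E₁ n))
    (hE₂ : ∀ n : ℕ, 1 ≤ n → Measurable[ℱ n] (E₂ n)) {l : ℕ → Ω → ℝ} (hl : IsStrategy ℱ l)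
    (hQ : IIDPairs ℱ E₁ E₂ Q) (h₁ : ∀ᵐ ω ∂Q, 0 ≤ E₁ 1 ω) (h₂ : ∀ᵐ ω ∂Q, 0 ≤ E₂ 1 ω) {ε : ℝ}
    (hε : 0 < ε) (hε1 : ε ≤ 1) : ∃ x ∈ Set.Icc (0 : ℝ) 1, ∀ᵐ ω ∂Q, ∀ᶠ n : ℕ in atTop,
      wealth E₁ E₂ l n ω ≤ Real.exp (2 * ε * n) * constWealth E₁ E₂ n ω x := by
  obtain ⟨x, hx, hx₁, hx₂⟩ := exists_near_numeraire ((hE₁ 1 le_rfl).mono (ℱ.le 1) le_rfl)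
    ((hE₂ 1 le_rfl).mono (ℱ.le 1) le_rfl) h₁ h₂ hε hε1
  refine ⟨x, ⟨hx.1.le, hx.2.le⟩, ?_⟩
  set g₁ : ℝ × ℝ → ENNReal := fun e => ENNReal.ofReal (e.1 / ((1 - x) * e.1 + x * e.2)) with hg₁
  set g₂ : ℝ × ℝ → ENNReal := fun e => ENNReal.ofReal (e.2 / ((1 - x) * e.1 + x * e.2)) with hg₂
  have hm₁ : Measurable g₁ := by fun_prop
  have hm₂ : Measurable g₂ := by fun_prop
  have hmean := lintegral_betProduct_le hE₁ hE₂ hl hm₁ hm₂ hQ hx₁ hx₂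
  have hexp : ENNReal.ofReal (1 + ε) ≤ ENNReal.ofReal (Real.exp ε) :=
    ENNReal.ofReal_le_ofReal (by linarith [Real.add_one_le_exp ε])
  -- Markov's inequality: the mean is at most `exp (ε * n)` and the threshold is `exp (2 * ε * n)`,
  -- leaving a summable geometric tail for Borel–Cantelli.
  have htail : ∀ n : ℕ, Q {ω | ENNReal.ofReal (Real.exp (2 * ε * n)) ≤
      betProduct E₁ E₂ l g₁ g₂ n ω} ≤ ENNReal.ofReal (Real.exp (-ε)) ^ n := fun n => by
    refine (meas_ge_le_lintegral_div
      ((measurable_betProduct hE₁ hE₂ hl hm₁ hm₂ n).mono (ℱ.le n) le_rfl).aemeasurable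
      (ENNReal.ofReal_pos.2 (Real.exp_pos _)).ne' ENNReal.ofReal_ne_top).trans ?_
    refine ENNReal.div_le_of_le_mul ?_
    refine (hmean n).trans ((pow_le_pow_left' hexp n).trans_eq ?_)
    rw [← ENNReal.ofReal_pow (Real.exp_pos _).le, ← ENNReal.ofReal_pow (Real.exp_pos _).le,
      ← ENNReal.ofReal_mul (by positivity), ← Real.exp_nat_mul, ← Real.exp_nat_mul, ← Real.exp_add]
    congr 2; ring
  have hsum : ∑' n : ℕ, Q {ω | ENNReal.ofReal (Real.exp (2 * ε * n)) ≤
      betProduct E₁ E₂ l g₁ g₂ n ω} ≠ ⊤ := by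
    refine ne_top_of_le_ne_top ?_ (ENNReal.tsum_le_tsum htail)
    rw [ENNReal.tsum_geometric, ENNReal.inv_ne_top]
    refine (tsub_pos_of_lt ?_).ne'
    rw [← ENNReal.ofReal_one]
    exact (ENNReal.ofReal_lt_ofReal_iff zero_lt_one).2 (by rw [← Real.exp_zero]; exact Real.exp_lt_exp.2 (by linarith))
  filter_upwards [ae_eventually_notMem hsum, hQ.ae_nonneg h₁ h₂] with ω hω hnn
  filter_upwards [hω] with n hn
  have hc := constWealth_nonneg hnn.1 hnn.2 n ⟨hx.1.le, hx.2.le⟩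
  refine (ENNReal.ofReal_le_ofReal_iff (mul_nonneg (Real.exp_pos _).le hc)).1 ?_
  rw [ofReal_wealth_eq_betProduct_mul_constWealth hx (fun n => (hl n).2 ω) hnn.1 hnn.2 n,
    ENNReal.ofReal_mul (Real.exp_pos _).le]
  gcongr
  exact (not_le.1 hn).le

/-! ### Logarithmic differences -/

theorem logDiff_eq_log_sub_log {x y : ℝ} (hx : 0 < x) (hy : 0 < y) :
    logDiff x y = ((Real.log x - Real.log y : ℝ) : EReal) := by
  rw [logDiff, if_neg (fun h => hx.not_ge h.1), ENNReal.log_ofReal_of_pos hx,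
    ENNReal.log_ofReal_of_pos hy, EReal.coe_sub]

/-- The degenerate values do no harm: `x ≤ 0` forces `y ≤ 0`, where the difference is `0` by
convention, and `y ≤ 0 < x` gives `⊤`. -/
theorem neg_log_le_logDiff {x y C : ℝ} (hC : 1 ≤ C) (hxy : y ≤ C * x) :
    ((-Real.log C : ℝ) : EReal) ≤ logDiff x y := by
  have hC0 : 0 < C := by linarith
  have hlog : ((-Real.log C : ℝ) : EReal) ≤ 0 := by
    exact_mod_cast neg_nonpos.2 (Real.log_nonneg hC)
  rcases le_or_gt x 0 with hx | hx
  · have hy : y ≤ 0 := hxy.trans (mul_nonpos_of_nonneg_of_nonpos hC0.le hx)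
    rw [logDiff, if_pos ⟨hx, hy⟩]; exact hlog
  rcases le_or_gt y 0 with hy | hy
  · rw [logDiff, if_neg (fun h => hx.not_ge h.1), ENNReal.log_ofReal_of_pos hx,
      ENNReal.ofReal_of_nonpos hy, ENNReal.log_zero, EReal.coe_sub_bot]
    exact le_top
  · rw [logDiff_eq_log_sub_log hx hy, EReal.coe_le_coe_iff]
    have := Real.log_le_log hy hxy
    rw [Real.log_mul hC0.ne' hx.ne'] at this
    linarith

theorem logDiff_eq_coe_of_le_mul {x y C : ℝ} (hC : 1 ≤ C) (hxy : x ≤ C * y)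
    (hyx : y ≤ C * x) : ∃ d : ℝ, logDiff x y = d ∧ |d| ≤ Real.log C := by
  have hC0 : 0 < C := by linarith
  rcases le_or_gt x 0 with hx | hx
  · have hy : y ≤ 0 := hyx.trans (mul_nonpos_of_nonneg_of_nonpos hC0.le hx)
    exact ⟨0, by rw [logDiff, if_pos ⟨hx, hy⟩, EReal.coe_zero], by simpa using Real.log_nonneg hC⟩
  have hy : 0 < y := pos_of_mul_pos_right (hx.trans_le hxy) hC0.le
  refine ⟨_, logDiff_eq_log_sub_log hx hy, ?_⟩
  have h1 := Real.log_le_log hx hxy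
  have h2 := Real.log_le_log hy hyx
  rw [Real.log_mul hC0.ne' hx.ne'] at h2
  rw [Real.log_mul hC0.ne' hy.ne'] at h1
  rw [abs_le]; constructor <;> linarith

theorem one_le_two_mul_sqrt (n : ℕ) : 1 ≤ 2 * √((n : ℝ) + 1) := by
  have : 1 ≤ √((n : ℝ) + 1) := Real.one_le_sqrt.2 (by linarith [Nat.cast_nonneg (α := ℝ) n])
  linarith

theorem eventually_log_two_mul_sqrt_le_mul_sq (c : ℝ) (hc : 0 < c) :
    ∀ᶠ n : ℕ in atTop, Real.log (2 * √((n : ℝ) + 1)) ≤ c * Real.log n ^ 2 := by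
  have hlog : Tendsto (fun n : ℕ => Real.log n) atTop atTop :=
    Real.tendsto_log_atTop.comp tendsto_natCast_atTop_atTop
  -- The bound `log n ≥ 4` yields `n ≥ 4`, hence `2√(n+1) ≤ n ^ 2`; the bound `log n ≥ 2 / c`
  -- absorbs `2 log n` into `c log² n`.
  filter_upwards [hlog.eventually_ge_atTop (2 / c), hlog.eventually_ge_atTop 4,
    eventually_ge_atTop 1] with n h1 h2 hn
  have hn' : (1 : ℝ) ≤ n := by exact_mod_cast hn
  have h3 : Real.log (2 * √((n : ℝ) + 1)) ≤ 2 * Real.log n := by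
    rw [← Real.log_rpow (by linarith), Real.rpow_two]
    refine Real.log_le_log (by positivity) ?_
    have h4 : (4 : ℝ) ≤ n := h2.trans (Real.log_le_self (by linarith))
    have h5 : √((n : ℝ) + 1) ≤ n := by
      rw [Real.sqrt_le_left (by linarith)]; nlinarith
    nlinarith
  have h6 : 2 ≤ c * Real.log n := by rwa [div_le_iff₀' hc] at h1
  nlinarith

theorem eventually_log_two_mul_sqrt_le_mul (c : ℝ) (hc : 0 < c) :
    ∀ᶠ n : ℕ in atTop, Real.log (2 * √((n : ℝ) + 1)) ≤ c * n := by
  have h := (Real.isLittleO_pow_log_id_atTop (n := 2)).bound (zero_lt_one (α := ℝ))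
  filter_upwards [eventually_log_two_mul_sqrt_le_mul_sq c hc, tendsto_natCast_atTop_atTop.eventually h]
    with n h1 h2
  simp only [id, one_mul, Real.norm_eq_abs, abs_pow, sq_abs, Nat.abs_cast] at h2
  exact h1.trans (mul_le_mul_of_nonneg_left h2 hc.le)

/-! ### The three processes belong to the class -/

theorem measurable_constWealth_comp (hE₁ : ∀ n : ℕ, 1 ≤ n → Measurable[ℱ n] (E₁ n))
    (hE₂ : ∀ n : ℕ, 1 ≤ n → Measurable[ℱ n] (E₂ n)) (n : ℕ) {x : Ω → ℝ}
    (hx : Measurable[ℱ n] x) : Measurable[ℱ n] fun ω => constWealth E₁ E₂ n ω (x ω) := by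
  refine Finset.measurable_fun_prod (Finset.Icc 1 n) fun i hi => ?_
  obtain ⟨hi1, hin⟩ := Finset.mem_Icc.1 hi
  exact ((measurable_const.sub hx).mul ((hE₁ i hi1).mono (ℱ.mono hin) le_rfl)).add
    (hx.mul ((hE₂ i hi1).mono (ℱ.mono hin) le_rfl))

/-- The subset expansion makes the integral a polynomial in the stock values up to time `n`, so
measurability with respect to `ℱ n` needs no argument about parametric integrals. -/
theorem measurable_integral_mul_constWealth (hE₁ : ∀ n : ℕ, 1 ≤ n → Measurable[ℱ n] (E₁ n))
    (hE₂ : ∀ n : ℕ, 1 ≤ n → Measurable[ℱ n] (E₂ n)) (n : ℕ) {f : ℝ → ℝ} (hf : Continuous f) :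
    Measurable[ℱ n] fun ω =>
      ∫ x, f x * constWealth E₁ E₂ n ω x ∂(betaMeasure (1 / 2) (1 / 2)) := by
  have hsum : (fun ω => ∫ x, f x * constWealth E₁ E₂ n ω x ∂(betaMeasure (1 / 2) (1 / 2))) =
      fun ω => ∑ t ∈ (Finset.Icc 1 n).powerset,
        ((∏ i ∈ t, E₂ i ω) * ∏ i ∈ Finset.Icc 1 n \ t, E₁ i ω) *
        ∫ x, f x * (x ^ t.card * (1 - x) ^ (n - t.card)) ∂(betaMeasure (1 / 2) (1 / 2)) := by
    funext ω
    simp_rw [constWealth_eq_sum, Finset.mul_sum]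
    rw [integral_finsetSum _ fun t _ =>
      integrable_betaMeasure_of_continuous (by norm_num) (by norm_num) (by fun_prop)]
    refine Finset.sum_congr rfl fun t _ => ?_
    rw [← integral_const_mul]
    congr 1; funext x; ring
  rw [hsum]
  refine Finset.measurable_fun_sum _ fun t ht => Measurable.mul_const (Measurable.mul ?_ ?_) _
  · refine Finset.measurable_fun_prod _ fun i hi => ?_
    obtain ⟨hi1, hin⟩ := Finset.mem_Icc.1 (Finset.mem_powerset.1 ht hi)
    exact (hE₂ i hi1).mono (ℱ.mono hin) le_rfl
  · refine Finset.measurable_fun_prod _ fun i hi => ?_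
    obtain ⟨hi1, hin⟩ := Finset.mem_Icc.1 (Finset.sdiff_subset hi)
    exact (hE₁ i hi1).mono (ℱ.mono hin) le_rfl

theorem measurable_upBet_succ (hE₁ : ∀ n : ℕ, 1 ≤ n → Measurable[ℱ n] (E₁ n))
    (hE₂ : ∀ n : ℕ, 1 ≤ n → Measurable[ℱ n] (E₂ n)) (n : ℕ) :
    Measurable[ℱ n] (upBet E₁ E₂ (n + 1)) := by
  have h1 := measurable_integral_mul_constWealth hE₁ hE₂ n continuous_id
  have h2 := measurable_integral_mul_constWealth hE₁ hE₂ n (continuous_const (y := (1 : ℝ)))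
  simp only [id, one_mul] at h1 h2
  exact h1.div h2

theorem measurable_wealthCO (hE₁ : ∀ n : ℕ, 1 ≤ n → Measurable[ℱ n] (E₁ n))
    (hE₂ : ∀ n : ℕ, 1 ≤ n → Measurable[ℱ n] (E₂ n)) (n : ℕ) (h : Measurable[ℱ n] (lmax n)) :
    Measurable[ℱ n] (wealthCO E₁ E₂ lmax n) :=
  (measurable_constWealth_comp hE₁ hE₂ n h).mul_const _

theorem measurable_regretOJ (n : ℕ) : Measurable (regretOJ n) := by
  refine Real.measurable_log.comp ?_
  have := Finset.measurable_sup' (s := Finset.range (n + 1)) Finset.nonempty_range_add_one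
    (f := fun (j : ℕ) (x : ℝ) => Real.pi * x ^ j * (1 - x) ^ (n - j) * Real.Gamma ((n : ℝ) + 1) /
      (Real.Gamma ((j : ℝ) + 1 / 2) * Real.Gamma ((n : ℝ) - (j : ℝ) + 1 / 2)))
    (fun j _ => by fun_prop)
  convert this using 1
  funext x
  rw [Finset.sup'_apply]

theorem measurable_wealthOJ (hE₁ : ∀ n : ℕ, 1 ≤ n → Measurable[ℱ n] (E₁ n))
    (hE₂ : ∀ n : ℕ, 1 ≤ n → Measurable[ℱ n] (E₂ n)) (n : ℕ) (h : Measurable[ℱ n] (lmax n)) :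
    Measurable[ℱ n] (wealthOJ E₁ E₂ lmax n) :=
  (measurable_constWealth_comp hE₁ hE₂ n h).mul
    (Real.measurable_exp.comp ((measurable_regretOJ n).comp h).neg)

theorem ae_nonneg_of_mem_union (h𝒬 : IsAlternative ℱ E₁ E₂ 𝒬)
    (hP : P ∈ nullHypothesis ℱ E₁ E₂ ∪ 𝒬) :
    ∀ᵐ ω ∂P, (∀ n, 0 ≤ E₁ (n + 1) ω) ∧ ∀ n, 0 ≤ E₂ (n + 1) ω := by
  rcases hP with ⟨_, hiid, h₁, h₂⟩ | hP
  · exact hiid.ae_nonneg h₁.1 h₂.1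
  · obtain ⟨_, hiid, h₁, h₂⟩ := h𝒬 P hP
    exact hiid.ae_nonneg h₁ h₂

/-- Adapted processes between zero and the wealth of the universal portfolio belong to the class. -/
theorem mem_eProcessClass_of_le_wealthUP (hE₁ : ∀ n : ℕ, 1 ≤ n → Measurable[ℱ n] (E₁ n))
    (hE₂ : ∀ n : ℕ, 1 ≤ n → Measurable[ℱ n] (E₂ n)) (h𝒬 : IsAlternative ℱ E₁ E₂ 𝒬)
    {W : ℕ → Ω → ℝ} (hW : ∀ n, Measurable[ℱ n] (W n))
    (hle : ∀ n ω, (∀ n, 0 ≤ E₁ (n + 1) ω) → (∀ n, 0 ≤ E₂ (n + 1) ω) →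
      0 ≤ W n ω ∧ W n ω ≤ wealthUP E₁ E₂ n ω) :
    W ∈ eProcessClass ℱ E₁ E₂ 𝒬 := by
  -- A strategy must take values in `[0, 1]` at every `ω`, but the universal bet is only known to do
  -- so where the stocks are nonnegative. Clamping changes nothing there.
  set l : ℕ → Ω → ℝ := fun n ω => max 0 (min 1 (upBet E₁ E₂ n ω)) with hl
  have hstrat : IsStrategy ℱ l := fun n =>
    ⟨measurable_const.max (measurable_const.min (measurable_upBet_succ hE₁ hE₂ n)),
      fun ω => ⟨le_max_left _ _, max_le zero_le_one (min_le_left _ _)⟩⟩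
  have hbd : ∀ P ∈ nullHypothesis ℱ E₁ E₂ ∪ 𝒬, ∀ n, 1 ≤ n →
      ∀ᵐ ω ∂P, 0 ≤ W n ω ∧ W n ω ≤ wealth E₁ E₂ l n ω := fun P hP n _ => by
    filter_upwards [ae_nonneg_of_mem_union h𝒬 hP] with ω hω
    have hlu : ∀ i, l i ω = upBet E₁ E₂ i ω := fun i => by
      obtain ⟨h0, h1⟩ := upBet_mem_Icc hω.1 hω.2 i
      simp only [hl]
      rw [min_eq_right h1, max_eq_right h0]
    have hw : wealth E₁ E₂ l n ω = wealthUP E₁ E₂ n ω := by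
      simp only [wealthUP, wealth, hlu]
    rw [hw]
    exact hle n ω hω.1 hω.2
  have hsup := fun P (hP : P ∈ nullHypothesis ℱ E₁ E₂) =>
    isTestSupermartingale_wealth hE₁ hE₂ hstrat hP
  refine ⟨⟨fun n _ => hW n, fun P hP => ⟨fun n hn => ?_, _, hsup P hP, fun n hn => ?_⟩⟩,
    l, hstrat, hsup, hbd⟩
  · exact (hbd P (Or.inl hP) n hn).mono fun _ h => h.1
  · exact (hbd P (Or.inl hP) n hn).mono fun _ h => h.2

/-! ### Log-optimality and equivalence -/

/-- Processes in the class that are within a factor `2 * √(n + 1)` of every constant strategy are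
log-optimal. -/
theorem isLogOptimal_of_constWealth_le (hE₁ : ∀ n : ℕ, 1 ≤ n → Measurable[ℱ n] (E₁ n))
    (hE₂ : ∀ n : ℕ, 1 ≤ n → Measurable[ℱ n] (E₂ n)) (h𝒬 : IsAlternative ℱ E₁ E₂ 𝒬) (hQ : Q ∈ 𝒬)
    {Wstar : ℕ → Ω → ℝ} (hmem : Wstar ∈ eProcessClass ℱ E₁ E₂ 𝒬)
    (hle : ∀ᵐ ω ∂Q, ∀ n : ℕ, ∀ x ∈ Set.Icc (0 : ℝ) 1,
      constWealth E₁ E₂ n ω x ≤ 2 * √((n : ℝ) + 1) * Wstar n ω) :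
    IsLogOptimal (eProcessClass ℱ E₁ E₂ 𝒬) Q Wstar := by
  refine ⟨hmem, fun W ⟨_, l, hl, _, hWl⟩ => ?_⟩
  obtain ⟨_, hiid, h₁, h₂⟩ := h𝒬 Q hQ
  -- The values `ε = 1 / (k + 1)` keep the exceptional null sets countable. The constant strategy
  -- depends on `k`, but the hypothesis on `Wstar` is uniform in `x` and eliminates it.
  have hgrowth : ∀ k : ℕ, ∀ᵐ ω ∂Q, ∀ᶠ n : ℕ in atTop, wealth E₁ E₂ l n ω ≤
      Real.exp (2 * (1 / ((k : ℝ) + 1)) * n) * (2 * √((n : ℝ) + 1) * Wstar n ω) := fun k => by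
    obtain ⟨x, hx, h⟩ := exists_const_wealth_growth hE₁ hE₂ hl hiid h₁ h₂
      (ε := 1 / ((k : ℝ) + 1)) (by positivity)
      (div_le_one_of_le₀ (by linarith [Nat.cast_nonneg (α := ℝ) k]) (by positivity))
    filter_upwards [h, hle] with ω hω hωle
    filter_upwards [hω] with n hn
    exact hn.trans (mul_le_mul_of_nonneg_left (hωle n x hx) (Real.exp_pos _).le)
  have hW : ∀ᵐ ω ∂Q, ∀ n, 1 ≤ n → W n ω ≤ wealth E₁ E₂ l n ω :=
    ae_all_iff.2 fun n => by
      by_cases hn : 1 ≤ n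
      · filter_upwards [hWl Q (Or.inr hQ) n hn] with ω hω _ using hω.2
      · exact ae_of_all _ fun _ h => absurd h hn
  filter_upwards [ae_all_iff.2 hgrowth, hW] with ω hω hωW
  -- Of the loss `3ε`, the part `2ε` comes from the growth bound and `ε` from `log (2√(n+1)) ≤ ε *
  -- n`.
  have hlim : ∀ k : ℕ, ((-(3 * (1 / ((k : ℝ) + 1))) : ℝ) : EReal) ≤
      liminf (fun n : ℕ => ((1 / (n : ℝ) : ℝ) : EReal) * logDiff (Wstar n ω) (W n ω)) atTop := by
    intro k
    set ε : ℝ := 1 / ((k : ℝ) + 1) with hε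
    have hε0 : 0 < ε := by positivity
    refine le_liminf_of_le (by isBoundedDefault) ?_
    filter_upwards [hω k, eventually_ge_atTop 1, eventually_log_two_mul_sqrt_le_mul ε hε0]
      with n hn hn1 hlog
    have hn0 : (0 : ℝ) < n := by exact_mod_cast hn1
    have hCn := one_le_two_mul_sqrt n
    have hC : 1 ≤ Real.exp (2 * ε * n) * (2 * √((n : ℝ) + 1)) :=
      one_le_mul_of_one_le_of_one_le (Real.one_le_exp (by positivity)) hCn
    have hd := neg_log_le_logDiff hC
      (((hωW n hn1).trans hn).trans_eq (mul_assoc _ _ _).symm)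
    refine le_trans ?_ (mul_le_mul_of_nonneg_left hd
      (by exact_mod_cast (by positivity : (0 : ℝ) ≤ 1 / n)))
    rw [← EReal.coe_mul, EReal.coe_le_coe_iff, Real.log_mul (Real.exp_pos _).ne' (by positivity),
      Real.log_exp, one_div, inv_mul_eq_div, le_div_iff₀ hn0]
    linarith
  refine le_of_forall_lt fun c hc => ?_
  obtain ⟨r, hcr, hr⟩ := EReal.lt_iff_exists_real_btwn.1 hc
  have hr0 : 0 < -r / 3 := by
    have : r < 0 := by exact_mod_cast hr
    linarith
  obtain ⟨k, hk⟩ := exists_nat_one_div_lt hr0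
  refine hcr.trans_le (le_trans ?_ (hlim k))
  rw [EReal.coe_le_coe_iff]
  linarith

/-- Processes in the class that are within a factor `2 * √(n + 1)` of each other are equivalent with
rate `log n ^ 2 / n`. -/
theorem asympEquiv_of_le_mul {𝒲 : Set (ℕ → Ω → ℝ)} {W W' : ℕ → Ω → ℝ} (hW : W ∈ 𝒲) (hW' : W' ∈ 𝒲)
    (h : ∀ᵐ ω ∂Q, ∀ n : ℕ, W n ω ≤ 2 * √((n : ℝ) + 1) * W' n ω ∧
      W' n ω ≤ 2 * √((n : ℝ) + 1) * W n ω) :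
    AsympEquiv 𝒲 Q (fun n : ℕ => Real.log n ^ 2) W W' := by
  refine ⟨hW, hW', ?_⟩
  filter_upwards [h] with ω hω c hc
  filter_upwards [eventually_log_two_mul_sqrt_le_mul_sq c hc, eventually_ge_atTop 1] with n hn hn1
  have hn0 : (0 : ℝ) < n := by exact_mod_cast hn1
  obtain ⟨d, hd, hdC⟩ := logDiff_eq_coe_of_le_mul (one_le_two_mul_sqrt n) (hω n).1 (hω n).2
  rw [hd, ← EReal.coe_mul, EReal.abs_def]
  refine ENNReal.ofReal_le_ofReal ?_
  rw [abs_mul, abs_of_nonneg (by positivity : (0 : ℝ) ≤ 1 / n),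
    abs_of_nonneg (by positivity : (0 : ℝ) ≤ Real.log n ^ 2 / n), one_div, inv_mul_eq_div,
    ← mul_div_assoc]
  exact div_le_div_of_nonneg_right (hdC.trans hn) hn0.le

/-- The order relations and regret bounds of the three processes for nonnegative stocks. -/
theorem ae_wealth_sandwich (h𝒬 : IsAlternative ℱ E₁ E₂ 𝒬) (hQ : Q ∈ 𝒬)
    (hlmax : IsArgmaxSelection ℱ E₁ E₂ lmax) : ∀ᵐ ω ∂Q, ∀ n : ℕ,
    0 ≤ wealthCO E₁ E₂ lmax n ω ∧
    wealthCO E₁ E₂ lmax n ω ≤ wealthOJ E₁ E₂ lmax n ω ∧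
    wealthOJ E₁ E₂ lmax n ω ≤ wealthUP E₁ E₂ n ω ∧
    wealthUP E₁ E₂ n ω ≤ 2 * √((n : ℝ) + 1) * wealthCO E₁ E₂ lmax n ω ∧
    ∀ x ∈ Set.Icc (0 : ℝ) 1,
      constWealth E₁ E₂ n ω x ≤ 2 * √((n : ℝ) + 1) * wealthCO E₁ E₂ lmax n ω := by
  filter_upwards [ae_nonneg_of_mem_union h𝒬 (Or.inr hQ)] with ω hω n
  exact wealth_sandwich hω.1 hω.2 n ((hlmax n).2 ω).1 ((hlmax n).2 ω).2

end

end Portfolio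

end

/-! ### Conclusion: membership, log-optimality, equivalence and order -/

theorem corollary1 {Ω : Type*} {m : MeasurableSpace Ω}
    (ℱ : MeasureTheory.Filtration ℕ m) (hℱ : ℱ 0 = ⊥)
    (E₁ E₂ : ℕ → Ω → ℝ)
    (hE₁ : ∀ n : ℕ, 1 ≤ n → Measurable[ℱ n] (E₁ n))
    (hE₂ : ∀ n : ℕ, 1 ≤ n → Measurable[ℱ n] (E₂ n))
    (𝒬 : Set (MeasureTheory.Measure Ω)) (h𝒬 : Portfolio.IsAlternative ℱ E₁ E₂ 𝒬)
    (lmax : ℕ → Ω → ℝ) (hlmax : Portfolio.IsArgmaxSelection ℱ E₁ E₂ lmax) :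
    (Portfolio.IsUniversallyLogOptimal (Portfolio.eProcessClass ℱ E₁ E₂ 𝒬) 𝒬
        (Portfolio.wealthUP E₁ E₂) ∧
      Portfolio.IsUniversallyLogOptimal (Portfolio.eProcessClass ℱ E₁ E₂ 𝒬) 𝒬
        (Portfolio.wealthCO E₁ E₂ lmax) ∧
      Portfolio.IsUniversallyLogOptimal (Portfolio.eProcessClass ℱ E₁ E₂ 𝒬) 𝒬
        (Portfolio.wealthOJ E₁ E₂ lmax)) ∧
    (∀ Q ∈ 𝒬,
      Portfolio.AsympEquiv (Portfolio.eProcessClass ℱ E₁ E₂ 𝒬) Q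
        (fun n : ℕ => Real.log n ^ 2)
        (Portfolio.wealthUP E₁ E₂) (Portfolio.wealthCO E₁ E₂ lmax) ∧
      Portfolio.AsympEquiv (Portfolio.eProcessClass ℱ E₁ E₂ 𝒬) Q
        (fun n : ℕ => Real.log n ^ 2)
        (Portfolio.wealthUP E₁ E₂) (Portfolio.wealthOJ E₁ E₂ lmax) ∧
      Portfolio.AsympEquiv (Portfolio.eProcessClass ℱ E₁ E₂ 𝒬) Q
        (fun n : ℕ => Real.log n ^ 2)
        (Portfolio.wealthCO E₁ E₂ lmax) (Portfolio.wealthOJ E₁ E₂ lmax)) ∧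
    (∀ Q ∈ 𝒬, ∀ᵐ ω ∂Q, ∀ n : ℕ,
      Portfolio.wealthCO E₁ E₂ lmax n ω ≤ Portfolio.wealthOJ E₁ E₂ lmax n ω ∧
      Portfolio.wealthOJ E₁ E₂ lmax n ω ≤ Portfolio.wealthUP E₁ E₂ n ω) := by
  have hs := fun {Q : MeasureTheory.Measure Ω} (hQ : Q ∈ 𝒬) =>
    Portfolio.ae_wealth_sandwich h𝒬 hQ hlmax
  -- The pathwise form is kept besides the almost sure one because membership in the class also
  -- concerns the laws of the null.
  have hsand := fun (n : ℕ) (ω : Ω) (h₁ : ∀ n, 0 ≤ E₁ (n + 1) ω) (h₂ : ∀ n, 0 ≤ E₂ (n + 1) ω) =>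
    Portfolio.wealth_sandwich h₁ h₂ n ((hlmax n).2 ω).1 ((hlmax n).2 ω).2
  have hUP : Portfolio.wealthUP E₁ E₂ ∈ Portfolio.eProcessClass ℱ E₁ E₂ 𝒬 :=
    Portfolio.mem_eProcessClass_of_le_wealthUP hE₁ hE₂ h𝒬
      (Portfolio.measurable_wealth hE₁ hE₂ (Portfolio.measurable_upBet_succ hE₁ hE₂))
      fun n ω h₁ h₂ => by
        obtain ⟨h0, hCO, hOJ, -, -⟩ := hsand n ω h₁ h₂
        exact ⟨h0.trans (hCO.trans hOJ), le_rfl⟩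
  have hCO : Portfolio.wealthCO E₁ E₂ lmax ∈ Portfolio.eProcessClass ℱ E₁ E₂ 𝒬 :=
    Portfolio.mem_eProcessClass_of_le_wealthUP hE₁ hE₂ h𝒬
      (fun n => Portfolio.measurable_wealthCO hE₁ hE₂ n (hlmax n).1)
      fun n ω h₁ h₂ => by
        obtain ⟨h0, hCO, hOJ, -, -⟩ := hsand n ω h₁ h₂
        exact ⟨h0, hCO.trans hOJ⟩
  have hOJ : Portfolio.wealthOJ E₁ E₂ lmax ∈ Portfolio.eProcessClass ℱ E₁ E₂ 𝒬 :=
    Portfolio.mem_eProcessClass_of_le_wealthUP hE₁ hE₂ h𝒬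
      (fun n => Portfolio.measurable_wealthOJ hE₁ hE₂ n (hlmax n).1)
      fun n ω h₁ h₂ => by
        obtain ⟨h0, hCO, hOJ, -, -⟩ := hsand n ω h₁ h₂
        exact ⟨h0.trans hCO, hOJ⟩
  have hC : ∀ n : ℕ, 0 ≤ 2 * √((n : ℝ) + 1) := fun n => by positivity
  have hself : ∀ (n : ℕ) {w : ℝ}, 0 ≤ w → w ≤ 2 * √((n : ℝ) + 1) * w := fun n w hw =>
    le_mul_of_one_le_left hw (Portfolio.one_le_two_mul_sqrt n)
  refine ⟨⟨⟨hUP, fun Q hQ => ?_⟩, ⟨hCO, fun Q hQ => ?_⟩, ⟨hOJ, fun Q hQ => ?_⟩⟩,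
    fun Q hQ => ⟨?_, ?_, ?_⟩, fun Q hQ => ?_⟩
  · refine Portfolio.isLogOptimal_of_constWealth_le hE₁ hE₂ h𝒬 hQ hUP ?_
    filter_upwards [hs hQ] with ω hω n x hx
    obtain ⟨-, hCO, hOJ, -, hx'⟩ := hω n
    exact (hx' x hx).trans (mul_le_mul_of_nonneg_left (hCO.trans hOJ) (hC n))
  · refine Portfolio.isLogOptimal_of_constWealth_le hE₁ hE₂ h𝒬 hQ hCO ?_
    filter_upwards [hs hQ] with ω hω n x hx using (hω n).2.2.2.2 x hx
  · refine Portfolio.isLogOptimal_of_constWealth_le hE₁ hE₂ h𝒬 hQ hOJ ?_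
    filter_upwards [hs hQ] with ω hω n x hx
    obtain ⟨-, hCO, -, -, hx'⟩ := hω n
    exact (hx' x hx).trans (mul_le_mul_of_nonneg_left hCO (hC n))
  · refine Portfolio.asympEquiv_of_le_mul hUP hCO ?_
    filter_upwards [hs hQ] with ω hω n
    obtain ⟨h0, hCO, hOJ, hUP, -⟩ := hω n
    exact ⟨hUP, (hCO.trans hOJ).trans (hself n (h0.trans (hCO.trans hOJ)))⟩
  · refine Portfolio.asympEquiv_of_le_mul hUP hOJ ?_
    filter_upwards [hs hQ] with ω hω n
    obtain ⟨h0, hCO, hOJ, hUP, -⟩ := hω n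
    exact ⟨hUP.trans (mul_le_mul_of_nonneg_left hCO (hC n)),
      hOJ.trans (hself n (h0.trans (hCO.trans hOJ)))⟩
  · refine Portfolio.asympEquiv_of_le_mul hCO hOJ ?_
    filter_upwards [hs hQ] with ω hω n
    obtain ⟨h0, hCO, hOJ, hUP, -⟩ := hω n
    exact ⟨hCO.trans (hself n (h0.trans hCO)), hOJ.trans hUP⟩
  · filter_upwards [hs hQ] with ω hω n using ⟨(hω n).2.1, (hω n).2.2.1⟩
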